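/- **Setting.** Let $X,Y,E,P_1,P_2$ be finite-dimensional Euclidean spaces, with duals denoted by $^*$, let $P:=P_1\times P_2$, $g\colon P\times X\to Y$, $f\colon P\times X\to X^*$, $C\subset Y$ closed, and $\bar z=(\bar p,\bar x)\in P\times X$ with $\bar p=(\bar p_1,\bar p_2)$ and $g(\bar z)\in C$. For a set $\Omega$ and $z\in\Omega$, $T_\Omega(z)$ is the (Bouligand) contingent cone, $N_\Omega(z)=\{z^*\mid\limsup_{y\to z,\,y\in\Omega}\langle z^*,y-z\rangle/\|y-z\|\le 0\}$ the regular normal cone ($N_\Omega(z)=\emptyset$ if $z\notin\Omega$), and $\mathcal K_\Omega(z,z^*)=T_\Omega(z)\cap\{z^*\}^\perp$. Put $\Gamma(p)=\{x\in X\mid g(p,x)\in C\}$ and $$S(p)=\{x\in X\mid 0\in f(p,x)+N_{\Gamma(p)}(x)\}.$$ Assume that $\bar x\in S(\bar p)$, that $g$ is $C^2$ and $f$ is $C^1$ around $\bar z$, and that $C$ is $C^2$-reducible at $g(\bar z)$ to a closed convex cone $K\subset E$: there are an open neighborhood $V$ of $g(\bar z)$ and a $C^2$ mapping $h\colon V\to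 E$ with $h(g(\bar z))=0$, $\nabla h(g(\bar z))$ surjective, and $C\cap V=\{y\in V\mid h(y)\in K\}$. Write ${\rm lin}\,K=K\cap(-K)$. For $\lambda\in N_C(g(\bar z))$ let $\mu_\lambda\in E^*$ be the unique element with $\nabla h(g(\bar z))^*\mu_\lambda=\lambda$, and define $\mathcal F_\lambda\colon X\to X^*$ by $$\mathcal F_\lambda u=\nabla_xf(\bar z)u+\nabla_x^2\langle\lambda,g\rangle(\bar z)u+\nabla_xg(\bar z)^*\,\nabla^2\langle\mu_\lambda,h\rangle(g(\bar z))\,\nabla_xg(\bar z)u .$$ Let $\bar\Lambda=\{\lambda\in N_C(g(\bar z))\mid f(\bar z)+\nabla_xg(\bar z)^*\lambda=0\}$, $\Lambda(\bar z,z^*)=\{\lambda\in N_C(g(\bar z))\mid\nabla g(\bar z)^*\lambda=z^*\}$, let $\Lambda(\bar z,z^*;v)$ be the set of maximizers over $\lambda\in\Lambda(\bar z,z^*)$ of $$\langle\lambda,\nabla^2g(\bar z)(v,v)\rangle+\nabla^2\langle\mu_\lambda,h\rangle(g(\bar z))(\nabla g(\bar z)v,\nabla g(\bar z)v),$$ and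 let $\mathcal K:=\mathcal K_{\Gamma(\bar p)}(\bar x,-f(\bar z))$. **Theorem.** Suppose that 1. (Robinson stability) there are $\kappa\ge0$ and neighborhoods $W$ of $\bar p$, $U$ of $\bar x$ with ${\rm dist}(x;\Gamma(p))\le\kappa\,{\rm dist}(g(p,x);C)$ for all $(p,x)\in W\times U$ (where ${\rm dist}(x;\emptyset)=\infty$); 2. (isolated calmness) there are $\ell>0$ and neighborhoods $Q$ of $\bar p$, $U$ of $\bar x$ with $\|x-\bar x\|\le\ell\|p-\bar p\|$ for all $p\in Q$ and $x\in S(p)\cap U$; 3. $g((p_1,p_2),x)=g((p_1,\bar p_2),x)$ for all $((p_1,p_2),x)\in P\times X$, and $\nabla_{p_2}f(\bar z)\colon P_2\to X^*$ is surjective. Then the following holds: (a) For every $0\ne u\in\mathcal K$, every $\lambda\in\bar\Lambda$ and every $\widehat\lambda\in\Lambda(\bar z,\nabla g(\bar z)^*\lambda;(0,u))$, either $\langle\mathcal F_{\widehat\lambda}u,u\rangle>0$ or $\langle\mathcal F_{\widehat\lambda}u,\widetilde u\rangle<0$ for some $\widetilde u\in\mathcal K$. (b) If in addition, for all $u\in\mathcal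 K$, $$\nabla h(g(\bar z))\nabla_x^2g(\bar z)(u,u)+\nabla^2h(g(\bar z))(\nabla_xg(\bar z)u,\nabla_xg(\bar z)u)\in{\rm rge}\big(\nabla h(g(\bar z))\circ\nabla g(\bar z)\big)+{\rm lin}\,K,$$ then for every $0\ne u\in\mathcal K$ and every $\lambda\in\bar\Lambda$, either $\langle\mathcal F_{\lambda}u,u\rangle>0$ or $\langle\mathcal F_{\lambda}u,\widetilde u\rangle<0$ for some $\widetilde u\in\mathcal K$. -/

import Mathlib

open Set Filter
open scoped Topology NNReal ENNReal

namespace PVS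

/-! ### Variational geometry -/

section Geometry

variable {Z : Type*} [NormedAddCommGroup Z] [NormedSpace ℝ Z]

/-- For `z ∈ Ω`, Mathlib's positive tangent cone is the Bouligand–Severi contingent cone: its
elements are the limits of `w k` with `z + t k • w k ∈ Ω` for some `t k ↓ 0`. -/
theorem mem_posTangentConeAt_iff_contingent {Ω : Set Z} {z : Z} (hz : z ∈ Ω) (y : Z) :
    y ∈ posTangentConeAt Ω z ↔ ∃ (t : ℕ → ℝ) (w : ℕ → Z), (∀ k, 0 < t k) ∧
      Tendsto t atTop (𝓝 0) ∧ Tendsto w atTop (𝓝 y) ∧ ∀ k, z + t k • w k ∈ Ω := by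
  constructor
  · intro hy
    by_cases hy0 : y = 0
    · subst hy0
      exact ⟨fun k => 1 / ((k : ℝ) + 1), fun _ => 0, fun k => by positivity,
        tendsto_one_div_add_atTop_nhds_zero_nat, tendsto_const_nhds, fun k => by simpa using hz⟩
    obtain ⟨c, d, hd, hds, hcd⟩ := mem_tangentConeAt_iff_exists_seq.1 hy
    have hne : ∀ᶠ n in atTop, c n • d n ≠ 0 := hcd.eventually_ne hy0
    obtain ⟨N, hN⟩ := eventually_atTop.1 (hds.and hne)
    have hc : ∀ n, N ≤ n → 0 < ((c n : ℝ≥0) : ℝ) := by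
      intro n hn
      refine lt_of_le_of_ne (c n).coe_nonneg fun h => (hN n hn).2 ?_
      simp [NNReal.smul_def, ← h]
    have hquot : Tendsto (fun n => ‖d n‖ / ‖c n • d n‖) atTop (𝓝 0) := by
      have := hd.norm.div hcd.norm (norm_ne_zero_iff.2 hy0)
      rw [norm_zero, zero_div] at this
      exact this
    refine ⟨fun k => ((c (k + N) : ℝ≥0) : ℝ)⁻¹, fun k => c (k + N) • d (k + N),
      fun k => inv_pos.2 (hc _ (by omega)), ?_,
      hcd.comp (tendsto_add_atTop_nat N), fun k => ?_⟩
    · refine (hquot.comp (tendsto_add_atTop_nat N)).congr fun k => ?_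
      have h1 := hc (k + N) (by omega)
      have h2 : d (k + N) ≠ 0 := fun h => (hN (k + N) (by omega)).2 (by simp [h])
      have h3 : ‖d (k + N)‖ ≠ 0 := norm_ne_zero_iff.2 h2
      simp only [Function.comp, NNReal.smul_def, norm_smul, Real.norm_eq_abs, abs_of_pos h1]
      field_simp
    · have h1 := hc (k + N) (by omega)
      simpa [NNReal.smul_def, smul_smul, inv_mul_cancel₀ h1.ne'] using (hN (k + N) (by omega)).1
  · rintro ⟨t, w, ht, ht0, hw, hmem⟩
    refine mem_tangentConeAt_of_seq atTop (fun k => (Real.toNNReal (t k)⁻¹))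
      (fun k => t k • w k) (by simpa using ht0.smul hw) (Eventually.of_forall hmem) ?_
    refine hw.congr fun k => ?_
    have h1 := ht k
    rw [NNReal.smul_def, Real.coe_toNNReal _ (inv_pos.2 h1).le, smul_smul,
      inv_mul_cancel₀ h1.ne', one_smul]

/-- The (Fréchet) regular normal cone to `Ω` at `z`, as a subset of the dual space. It is empty
if `z ∉ Ω`. The inequality says that the upper limit of `z* (y - z) / ‖y - z‖` over
`y → z`, `y ∈ Ω` is nonpositive. -/
def normalCone (Ω : Set Z) (z : Z) : Set (StrongDual ℝ Z) :=
  {zs | z ∈ Ω ∧ ∀ ε > 0, ∀ᶠ y in 𝓝[Ω] z, zs (y - z) ≤ ε * ‖y - z‖}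

/-- The critical cone to `Ω` at `(z, z*)`: the tangent vectors to `Ω` at `z` orthogonal to `z*`. -/
def criticalCone (Ω : Set Z) (z : Z) (zs : StrongDual ℝ Z) : Set Z :=
  {w | w ∈ posTangentConeAt Ω z ∧ zs w = 0}

end Geometry

variable {P X Y E : Type*}
  [NormedAddCommGroup P] [NormedSpace ℝ P]
  [NormedAddCommGroup X] [NormedSpace ℝ X]
  [NormedAddCommGroup Y] [NormedSpace ℝ Y]
  [NormedAddCommGroup E] [NormedSpace ℝ E]

/-- The closed set `C` is `C²`-reducible at `y ∈ C` to the closed convex cone `K` by means of the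
mapping `h` (which is only relevant on a neighborhood `V` of `y`). -/
def IsC2ConeReduction (C : Set Y) (K : ProperCone ℝ E) (h : Y → E) (y : Y) : Prop :=
  IsClosed C ∧ y ∈ C ∧ ∃ V : Set Y, IsOpen V ∧ y ∈ V ∧ ContDiffOn ℝ 2 h V ∧
    h y = 0 ∧ Function.Surjective (fderiv ℝ h y) ∧ C ∩ V = {v ∈ V | h v ∈ K}

/-- The feasible set mapping `Γ(p) = {x | g(p,x) ∈ C}`. -/
def feasibleSet (g : P × X → Y) (C : Set Y) (p : P) : Set X :=
  {x | g (p, x) ∈ C}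

/-- Robinson stability of the system `g(p,x) ∈ C` at `(p₀, x₀)`. The distance is the extended one,
so that the distance to the empty set is infinite. -/
def RobinsonStable (g : P × X → Y) (C : Set Y) (p₀ : P) (x₀ : X) : Prop :=
  ∃ κ : ℝ≥0, ∃ W ∈ 𝓝 p₀, ∃ U ∈ 𝓝 x₀, ∀ p ∈ W, ∀ x ∈ U,
    Metric.infEDist x (feasibleSet g C p) ≤ κ * Metric.infEDist (g (p, x)) C

/-- The solution map `S(p) = {x | 0 ∈ f(p,x) + N_{Γ(p)}(x)}` of the parametric variational
system. -/
def solutionMap (f : P × X → StrongDual ℝ X) (g : P × X → Y) (C : Set Y) (p : P) : Set X :=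
  {x | -f (p, x) ∈ normalCone (feasibleSet g C p) x}

/-- Isolated calmness of a set-valued mapping `S` at `(p₀, x₀)`. -/
def IsolatedlyCalm (S : P → Set X) (p₀ : P) (x₀ : X) : Prop :=
  ∃ ℓ > (0 : ℝ), ∃ Q ∈ 𝓝 p₀, ∃ U ∈ 𝓝 x₀, ∀ p ∈ Q, ∀ x ∈ S p ∩ U, ‖x - x₀‖ ≤ ℓ * ‖p - p₀‖

/-! ### Multipliers -/

/-- The multiplier set `Λ(z, z*) = {λ ∈ N_C(g(z)) | ∇g(z)* λ = z*}`. -/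
def multipliers (g : P × X → Y) (C : Set Y) (z : P × X) (zs : StrongDual ℝ (P × X)) :
    Set (StrongDual ℝ Y) :=
  {lam | lam ∈ normalCone C (g z) ∧ lam.comp (fderiv ℝ g z) = zs}

/-- `(∇h(y)*)⁻¹ λ`: the element `μ` with `∇h(y)* μ = μ ∘ ∇h(y) = λ`. It is unique if `∇h(y)` is
surjective, and it exists for all normals `λ` to a set reduced by `h` at `y`. -/
noncomputable def reducedMultiplier (h : Y → E) (y : Y) (lam : StrongDual ℝ Y) :
    StrongDual ℝ E :=
  Function.invFun (fun μ : StrongDual ℝ E => μ.comp (fderiv ℝ h y)) lam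

theorem reducedMultiplier_comp (h : Y → E) (y : Y)
    (hs : Function.Surjective (fderiv ℝ h y)) (μ : StrongDual ℝ E) :
    reducedMultiplier h y (μ.comp (fderiv ℝ h y)) = μ := by
  refine Function.leftInverse_invFun (f := fun μ : StrongDual ℝ E => μ.comp (fderiv ℝ h y)) ?_ μ
  intro a b hab
  ext e
  obtain ⟨w, rfl⟩ := hs e
  exact DFunLike.congr_fun hab w

/-- The Hessian `∇²⟨(∇h(y)*)⁻¹ λ, h(·)⟩(y)`. -/
noncomputable def curvature (h : Y → E) (y : Y) (lam : StrongDual ℝ Y) :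
    Y →L[ℝ] StrongDual ℝ Y :=
  fderiv ℝ (fderiv ℝ fun v => reducedMultiplier h y lam (h v)) y

/-- The directional multiplier set `Λ(z, z*; v)`: the maximizers over `λ ∈ Λ(z, z*)` of
`⟨λ, ∇²g(z)(v,v)⟩ + ∇²⟨(∇h(g(z))*)⁻¹ λ, h(·)⟩(g(z))(∇g(z)v, ∇g(z)v)`. -/
def directionalMultipliers (g : P × X → Y) (C : Set Y) (h : Y → E) (z : P × X)
    (zs : StrongDual ℝ (P × X)) (v : P × X) : Set (StrongDual ℝ Y) :=
  {lam | lam ∈ multipliers g C z zs ∧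
    IsMaxOn (fun l : StrongDual ℝ Y => l (fderiv ℝ (fderiv ℝ g) z v v) +
      curvature h (g z) l (fderiv ℝ g z v) (fderiv ℝ g z v)) (multipliers g C z zs) lam}

/-- The partial derivative `∇ₓg(p, x)`. -/
noncomputable def partialX {F : Type*} [NormedAddCommGroup F] [NormedSpace ℝ F]
    (g : P × X → F) (p : P) (x : X) : X →L[ℝ] F :=
  fderiv ℝ (fun x' => g (p, x')) x

/-- The second-order partial derivative `∇ₓ²g(p, x)`. -/
noncomputable def partialXX {F : Type*} [NormedAddCommGroup F] [NormedSpace ℝ F]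
    (g : P × X → F) (p : P) (x : X) : X →L[ℝ] X →L[ℝ] F :=
  fderiv ℝ (fderiv ℝ fun x' => g (p, x')) x

/-- The multiplier set `{λ ∈ N_C(g(p,x)) | f(p,x) + ∇ₓg(p,x)* λ = 0}` of the variational system. -/
def pvsMultipliers (f : P × X → StrongDual ℝ X) (g : P × X → Y) (C : Set Y) (p : P) (x : X) :
    Set (StrongDual ℝ Y) :=
  {lam | lam ∈ normalCone C (g (p, x)) ∧ f (p, x) + lam.comp (partialX g p x) = 0}

/-- The operator
`𝓗_λ u = ∇ₓg(p,x)* ∇²⟨(∇h(g(p,x))*)⁻¹ λ, h(·)⟩(g(p,x)) ∇ₓg(p,x) u`. -/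
noncomputable def opH (g : P × X → Y) (h : Y → E) (p : P) (x : X) (lam : StrongDual ℝ Y) (u : X) :
    StrongDual ℝ X :=
  (curvature h (g (p, x)) lam (partialX g p x u)).comp (partialX g p x)

/-- The operator `𝓕_λ u = ∇ₓf(p,x) u + ∇ₓ²⟨λ, g(·)⟩(p,x) u + 𝓗_λ u`. -/
noncomputable def opF (f : P × X → StrongDual ℝ X) (g : P × X → Y) (h : Y → E) (p : P) (x : X)
    (lam : StrongDual ℝ Y) (u : X) : StrongDual ℝ X :=
  partialX f p x u + partialXX (fun z => lam (g z)) p x u + opH g h p x lam u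

/-! ### The second-order conditions -/

/-- The critical cone `𝓚_{Γ(p)}(x, -f(p,x))`. -/
def pvsCriticalCone (f : P × X → StrongDual ℝ X) (g : P × X → Y) (C : Set Y) (p : P) (x : X) :
    Set X :=
  criticalCone (feasibleSet g C p) x (-f (p, x))

/-- The second-order condition with directional multipliers. -/
def SecondOrderCondition (f : P × X → StrongDual ℝ X) (g : P × X → Y) (C : Set Y) (h : Y → E)
    (p : P) (x : X) : Prop :=
  ∀ u ∈ pvsCriticalCone f g C p x, u ≠ 0 →
    ∀ lam ∈ pvsMultipliers f g C p x,
      ∀ lam' ∈ directionalMultipliers g C h (p, x) (lam.comp (fderiv ℝ g (p, x))) (0, u),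
        0 < opF f g h p x lam' u u ∨
          ∃ u' ∈ pvsCriticalCone f g C p x, opF f g h p x lam' u u' < 0

/-- The strong second-order condition, with all multipliers. -/
def StrongSecondOrderCondition (f : P × X → StrongDual ℝ X) (g : P × X → Y) (C : Set Y)
    (h : Y → E) (p : P) (x : X) : Prop :=
  ∀ u ∈ pvsCriticalCone f g C p x, u ≠ 0 →
    ∀ lam ∈ pvsMultipliers f g C p x,
      0 < opF f g h p x lam u u ∨
        ∃ u' ∈ pvsCriticalCone f g C p x, opF f g h p x lam u u' < 0

/-- The range condition: for all critical directions `u`,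
`∇h(g(z)) ∇ₓ²g(z)(u,u) + ∇²h(g(z))(∇ₓg(z)u, ∇ₓg(z)u)` belongs to
`rge (∇h(g(z)) ∘ ∇g(z)) + lin K`, where `z = (p,x)` and `∇g(z)` is the full derivative. -/
def RangeCondition (f : P × X → StrongDual ℝ X) (g : P × X → Y) (C : Set Y)
    (K : ProperCone ℝ E) (h : Y → E) (p : P) (x : X) : Prop :=
  ∀ u ∈ pvsCriticalCone f g C p x,
    fderiv ℝ h (g (p, x)) (partialXX g p x u u) +
        fderiv ℝ (fderiv ℝ h) (g (p, x)) (partialX g p x u) (partialX g p x u) ∈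
      LinearMap.range ((fderiv ℝ h (g (p, x))).comp (fderiv ℝ g (p, x))).toLinearMap ⊔
        PointedCone.lineal K.toSubmodule

end PVS

/-! Argue by contradiction. Put `q = h ∘ g`, with first and second derivatives `A` and `Q` at the
reference point, and write the directional multiplier as `∇h* μ`. By the chain rule `𝓕 u = ∇ₓf u + μ
Q(0,u)(0,·)`, so if the alternative fails at `u ≠ 0`, then for `w = -∇ₓf u` the functional `w - μ
Q(0,u)(0,·)` is normal to the critical cone at `u`. The heart of the proof,
`exists_normals_in_direction`, shows that `(0, u, w)` is then tangent to the graph of `(p,x) ↦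
N_{Γ(p)}(x)`: there are points with difference quotients tending to `(0,u)` and normals `x*` with `f
+ x* = o(t)`. Since `∇_{p₂} f` is surjective and `Γ` ignores `p₂`, an `o(t)` shift of `p₂` turns
these points into exact solutions (`IsolatedlyCalm.eq_zero_of_tangent`). They move at rate `t‖u‖`
under an `o(t)` parameter change, against isolated calmness.

The normals come from minimizing `penalty` over the graph of `Γ`: a minimizer also minimizes in `x`
alone, which gives a partial normal. Values are compared at order `t²`. The upper bound uses
feasible arcs built from approximate conic duality (`exists_approx_dual_solution`, where maximality
of `μ` enters) and Robinson stability. The lower bound uses `μ ≤ 0` on `K`. A large weight `R` then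
forces the limiting `x`-direction to be `u`. The weight `1/t` on the parameter makes a move of order
`t²` cost only `O(t³)`, yet keeps minimizers within `O(t^{3/2}) = o(t)` of the reference parameter.

Part (b) follows because the range condition makes the directional objective constant on the
multiplier set, so every multiplier is directional. -/

namespace PVS

/-! ### Metric regularity, Taylor expansion and conic duality -/

/-- Lyusternik–Graves: a strictly differentiable map with surjective derivative is metrically
regular. -/
theorem exists_preimage_dist_le_of_surjective {F G : Type*}
    [NormedAddCommGroup F] [NormedSpace ℝ F] [CompleteSpace F]
    [NormedAddCommGroup G] [NormedSpace ℝ G] [CompleteSpace G]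
    {φ : F → G} {φ' : F →L[ℝ] G} {a : F} (hφ : HasStrictFDerivAt φ φ' a)
    (hs : Function.Surjective φ') :
    ∃ c > (0 : ℝ), ∀ᶠ ye in 𝓝 (a, φ a), ∃ y', φ y' = ye.2 ∧ ‖y' - ye.1‖ ≤ c * ‖φ ye.1 - ye.2‖ := by
  have hr : φ'.range = ⊤ := LinearMap.range_eq_top.2 hs
  set N := φ'.nonlinearRightInverseOfSurjective hr
  have hN : (0 : ℝ) < N.nnnorm := φ'.nonlinearRightInverseOfSurjective_nnnorm_pos hr
  -- An approximation constant of half of `‖N‖⁻¹` leaves exactly `k = ‖N‖⁻¹ - k` as covering rate: a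
  -- ball of radius `r` covers one of radius `k r`, whence the modulus `k⁻¹`.
  set k : ℝ≥0 := N.nnnorm⁻¹ / 2 with hk
  have hk0 : (0 : ℝ) < k := by rw [hk]; push_cast; positivity
  obtain ⟨s, hsn, hA⟩ := hφ.approximates_deriv_on_nhds (c := k) (Or.inr (by exact_mod_cast hk0))
  obtain ⟨δ, hδ, hball⟩ := Metric.mem_nhds_iff.1 hsn
  have hkk : ((N.nnnorm : ℝ)⁻¹ - k) = k := by rw [hk]; push_cast; ring
  refine ⟨(k : ℝ)⁻¹, by positivity, ?_⟩
  have hcont : Tendsto (fun ye : F × G => (k : ℝ)⁻¹ * ‖φ ye.1 - ye.2‖) (𝓝 (a, φ a)) (𝓝 0) := by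
    have h1 : Tendsto (fun ye : F × G => φ ye.1) (𝓝 (a, φ a)) (𝓝 (φ a)) :=
      (hφ.continuousAt.tendsto).comp (continuous_fst.tendsto' _ _ rfl)
    have h2 : Tendsto (fun ye : F × G => ye.2) (𝓝 (a, φ a)) (𝓝 (φ a)) :=
      continuous_snd.tendsto' _ _ rfl
    simpa using ((h1.sub h2).norm.const_mul (k : ℝ)⁻¹)
  have h3 : ∀ᶠ ye : F × G in 𝓝 (a, φ a), ye.1 ∈ Metric.ball a (δ / 2) :=
    (continuous_fst.tendsto' (a, φ a) a rfl) (Metric.ball_mem_nhds a (half_pos hδ))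
  filter_upwards [h3, hcont.eventually (gt_mem_nhds (half_pos hδ))] with ye hy1 hy2
  set r := (k : ℝ)⁻¹ * ‖φ ye.1 - ye.2‖
  have hsub : Metric.closedBall ye.1 r ⊆ s := by
    refine Subset.trans ?_ hball
    intro w hw
    rw [Metric.mem_closedBall] at hw
    rw [Metric.mem_ball] at hy1 ⊢
    linarith [dist_triangle w ye.1 a]
  have hsurj := hA.surjOn_closedBall_of_nonlinearRightInverse N (ε := r) (by positivity) hsub
  have hmem : ye.2 ∈ Metric.closedBall (φ ye.1) (((N.nnnorm : ℝ)⁻¹ - k) * r) := by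
    rw [hkk, Metric.mem_closedBall, dist_comm, dist_eq_norm]
    simp only [r]
    rw [mul_inv_cancel_left₀ hk0.ne']
  obtain ⟨y', hy', hφy'⟩ := hsurj hmem
  exact ⟨y', hφy', by rwa [Metric.mem_closedBall, dist_eq_norm] at hy'⟩

/-- The second-order Taylor expansion with Peano remainder. -/
theorem taylor_two_isLittleO {F G : Type*}
    [NormedAddCommGroup F] [NormedSpace ℝ F] [NormedAddCommGroup G] [NormedSpace ℝ G]
    {φ : F → G} {a : F} (hφ : ContDiffAt ℝ 2 φ a) :
    (fun z => φ z - φ a - fderiv ℝ φ a (z - a) -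
        (2⁻¹ : ℝ) • fderiv ℝ (fderiv ℝ φ) a (z - a) (z - a)) =o[𝓝 a] fun z => ‖z - a‖ ^ 2 := by
  set Q := fderiv ℝ (fderiv ℝ φ) a
  have hsymm : ∀ v w, Q v w = Q w v := by
    intro v w
    exact (hφ.isSymmSndFDerivAt (by simp)).eq v w
  have hQ : HasFDerivAt (fderiv ℝ φ) Q a :=
    ((hφ.fderiv_right (m := 1) (by norm_num)).differentiableAt (by norm_num)).hasFDerivAt
  have hd : ∀ᶠ z in 𝓝 a, DifferentiableAt ℝ φ z := by
    filter_upwards [hφ.eventually (by simp)] with z hz using hz.differentiableAt (by norm_num)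
  rw [Asymptotics.isLittleO_iff]
  intro ε hε
  have h1 := (hasFDerivAt_iff_isLittleO.1 hQ).def hε
  obtain ⟨δ, hδ, hball⟩ := Metric.eventually_nhds_iff_ball.1 (h1.and hd)
  filter_upwards [Metric.ball_mem_nhds a hδ] with z hz
  -- By symmetry of `Q`, the remainder has derivative `∇φ y - ∇φ a - Q (y - a)`, of norm at most `ε
  -- ‖y - a‖`. The mean value inequality on the segment supplies the second factor `‖z - a‖`.
  set r : F → G := fun z => φ z - φ a - fderiv ℝ φ a (z - a) - (2⁻¹ : ℝ) • Q (z - a) (z - a)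
  have hr : ∀ y ∈ Metric.ball a δ,
      HasFDerivAt r (fderiv ℝ φ y - fderiv ℝ φ a - Q (y - a)) y := by
    intro y hy
    have e1 := (hball y hy).2.hasFDerivAt
    have e2 : HasFDerivAt (fun z : F => z - a) (ContinuousLinearMap.id ℝ F) y :=
      (hasFDerivAt_id y).sub_const a
    have e3 := ((fderiv ℝ φ a).hasFDerivAt (x := y - a)).comp y e2
    have e4 := ((Q.hasFDerivAt (x := y - a)).comp y e2).clm_apply e2
    refine (((e1.sub_const (φ a)).sub e3).sub (e4.const_smul (2⁻¹ : ℝ))).congr_fderiv ?_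
    ext v
    have e5 : (2⁻¹ : ℝ) • (Q (y - a) v + Q (y - a) v) = Q (y - a) v := by
      rw [← two_smul ℝ, smul_smul]
      norm_num
    simpa [hsymm v y, hsymm v a] using e5
  have hseg : segment ℝ a z ⊆ Metric.ball a δ :=
    (convex_ball a δ).segment_subset (Metric.mem_ball_self hδ) hz
  have hb := (convex_segment a z).norm_image_sub_le_of_norm_hasFDerivWithin_le
    (f := r) (f' := fun y => fderiv ℝ φ y - fderiv ℝ φ a - Q (y - a)) (C := ε * ‖z - a‖)
    (fun y hy => (hr y (hseg hy)).hasFDerivWithinAt)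
    (fun y hy => ((hball y (hseg hy)).1).trans (by
      gcongr
      rw [segment_eq_image'] at hy
      obtain ⟨θ, hθ, rfl⟩ := hy
      simp only [add_sub_cancel_left, norm_smul, Real.norm_eq_abs, abs_of_nonneg hθ.1]
      exact mul_le_of_le_one_left (norm_nonneg _) hθ.2))
    (left_mem_segment ℝ a z) (right_mem_segment ℝ a z)
  have hra : r a = 0 := by simp [r]
  rw [hra, sub_zero] at hb
  rw [norm_pow, norm_norm, pow_two, ← mul_assoc]
  exact hb

/-- Approximate conic duality: if `μ₀` maximizes `⟨μ, b⟩` over the elements `μ` of the polar cone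
of `K` with `A* μ = A* μ₀`, then the dual problem has approximate solutions with values arbitrarily
close to the maximum. -/
theorem exists_approx_dual_solution {F E : Type*}
    [NormedAddCommGroup F] [NormedSpace ℝ F] [NormedAddCommGroup E] [NormedSpace ℝ E]
    (K : ProperCone ℝ E) (A : F →L[ℝ] E) (b : E) (μ₀ : StrongDual ℝ E)
    (hμ₀ : ∀ k ∈ K, μ₀ k ≤ 0)
    (hmax : ∀ μ : StrongDual ℝ E, (∀ k ∈ K, μ k ≤ 0) → μ.comp A = μ₀.comp A → μ b ≤ μ₀ b)
    {ε : ℝ} (hε : 0 < ε) :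
    ∃ w : F, ∃ k ∈ K, ‖b + A w - k‖ < ε ∧ -μ₀ (A w) < μ₀ b + ε := by
  -- The dual problem minimizes `-μ₀ (A w)` subject to `b + A w ∈ K`. `D` collects the right-hand
  -- sides with upper bounds for their cost. It need not be closed, so only approximate solutions
  -- are obtained.
  let D : PointedCone ℝ (E × ℝ) :=
    { carrier := {x | ∃ k ∈ K, ∃ w : F, ∃ r : ℝ, 0 ≤ r ∧ x = (k - A w, -μ₀ (A w) + r)}
      zero_mem' := ⟨0, K.zero_mem, 0, 0, le_rfl, by simp [← Prod.zero_eq_mk]⟩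
      add_mem' := by
        rintro _ _ ⟨k, hk, w, r, hr, rfl⟩ ⟨k', hk', w', r', hr', rfl⟩
        refine ⟨k + k', K.add_mem hk hk', w + w', r + r', by positivity, ?_⟩
        simp only [Prod.mk_add_mk, map_add, Prod.mk.injEq]
        exact ⟨by abel, by ring⟩
      smul_mem' := by
        rintro c _ ⟨k, hk, w, r, hr, rfl⟩
        refine ⟨c • k, K.toSubmodule.smul_mem c hk, (c : ℝ) • w, c * r, mul_nonneg c.2 hr, ?_⟩
        simp only [Prod.smul_mk, map_smul, Prod.mk.injEq, smul_sub, smul_add, smul_neg]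
        exact ⟨rfl, rfl⟩ }
  have hmem : (b, μ₀ b) ∈ closure (D : Set (E × ℝ)) := by
    by_contra hnot
    let D' : ProperCone ℝ (E × ℝ) := ⟨D.closure, isClosed_closure⟩
    obtain ⟨φ, hφ, hφb⟩ := D'.hyperplane_separation_point (x₀ := (b, μ₀ b)) hnot
    have hφD : ∀ k ∈ K, ∀ w : F, ∀ r : ℝ, 0 ≤ r → 0 ≤ φ (k - A w, -μ₀ (A w) + r) :=
      fun k hk w r hr => hφ _ (subset_closure ⟨k, hk, w, r, hr, rfl⟩)
    let ν : StrongDual ℝ E := -(φ.comp (ContinuousLinearMap.inl ℝ E ℝ))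
    set ρ : ℝ := φ (0, 1) with hρ
    have hsplit : ∀ e s, φ (e, s) = -ν e + s * ρ := by
      intro e s
      have : (e, s) = (e, (0 : ℝ)) + s • ((0 : E), (1 : ℝ)) := by simp
      rw [this, map_add, map_smul]
      simp [ν, hρ]
    have hρ0 : 0 ≤ ρ := by
      have := hφD 0 K.zero_mem 0 1 zero_le_one
      simpa [hsplit] using this
    have hνK : ∀ k ∈ K, ν k ≤ 0 := by
      intro k hk
      have := hφD k hk 0 0 le_rfl
      simpa [hsplit] using this
    have hνA : ∀ w, ν (A w) = ρ * μ₀ (A w) := by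
      have key : ∀ w, 0 ≤ ν (A w) - ρ * μ₀ (A w) := by
        intro w
        have := hφD 0 K.zero_mem w 0 le_rfl
        simp only [hsplit, zero_sub, map_neg, neg_neg, add_zero] at this
        linarith
      intro w
      have h1 := key w
      have h2 := key (-w)
      simp only [map_neg] at h2
      linarith
    rw [hsplit] at hφb
    -- The separating functional yields `ν` in the polar cone with `ν A = ρ μ₀ A` and `ν b > ρ μ₀
    -- b`. Either `μ₀ + ν` (if `ρ = 0`) or `ν / ρ` is feasible and beats `μ₀`.
    rcases hρ0.eq_or_lt with h0 | hpos
    · have := hmax (μ₀ + ν) (fun k hk => by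
        have := hμ₀ k hk
        have := hνK k hk
        simp only [add_apply]
        linarith) (by
          ext w
          simp [hνA, ← h0])
      simp only [add_apply] at this
      rw [← h0] at hφb
      linarith
    · have := hmax (ρ⁻¹ • ν) (fun k hk => by
        have := hνK k hk
        simp only [smul_apply, smul_eq_mul]
        exact mul_nonpos_of_nonneg_of_nonpos (by positivity) this) (by
          ext w
          simp [hνA, hpos.ne'])
      simp only [smul_apply, smul_eq_mul] at this
      rw [inv_mul_le_iff₀ hpos] at this
      linarith
  obtain ⟨x, ⟨k, hk, w, r, hr, rfl⟩, hx⟩ := Metric.mem_closure_iff.1 hmem ε hε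
  rw [Prod.dist_eq, max_lt_iff, dist_eq_norm, dist_eq_norm, Real.norm_eq_abs, abs_lt] at hx
  refine ⟨w, k, hk, ?_, ?_⟩
  · have : b + A w - k = b - (k - A w) := by abel
    rw [this]
    exact hx.1
  · have := hx.2.1
    simp only at this
    linarith

/-! ### Tangents, normals and rays -/

/-- A vector is tangent as soon as the ray it spans approximates the set to first order. -/
theorem mem_posTangentConeAt_of_approx {Z : Type*} [NormedAddCommGroup Z] [NormedSpace ℝ Z]
    {Ω : Set Z} {z v : Z} (hz : z ∈ Ω)
    (h : ∀ ε > (0 : ℝ), ∀ᶠ t : ℝ in 𝓝[>] 0, ∃ y ∈ Ω, ‖y - (z + t • v)‖ ≤ ε * t) :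
    v ∈ posTangentConeAt Ω z := by
  rw [mem_posTangentConeAt_iff_contingent hz]
  have hk : ∀ k : ℕ, (0 : ℝ) < 1 / ((k : ℝ) + 1) := fun k => by positivity
  have h1 : ∀ k : ℕ, ∃ t : ℝ, ∃ y ∈ Ω, 0 < t ∧ t < 1 / ((k : ℝ) + 1) ∧
      ‖y - (z + t • v)‖ ≤ 1 / ((k : ℝ) + 1) * t := by
    intro k
    obtain ⟨t, ⟨y, hy, hyt⟩, ht⟩ := ((h _ (hk k)).and (Ioo_mem_nhdsGT (hk k))).exists
    exact ⟨t, y, hy, ht.1, ht.2, hyt⟩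
  choose t y hy ht0 ht1 hyt using h1
  have hlim := tendsto_one_div_add_atTop_nhds_zero_nat (𝕜 := ℝ)
  refine ⟨t, fun k => (t k)⁻¹ • (y k - z), ht0,
    squeeze_zero (fun k => (ht0 k).le) (fun k => (ht1 k).le) hlim, ?_, fun k => ?_⟩
  · rw [tendsto_iff_norm_sub_tendsto_zero]
    refine squeeze_zero (fun _ => norm_nonneg _) (fun k => ?_) hlim
    have e : (t k)⁻¹ • (y k - z) - v = (t k)⁻¹ • (y k - (z + t k • v)) := by
      rw [← sub_sub, smul_sub _ (y k - z), smul_smul, inv_mul_cancel₀ (ht0 k).ne', one_smul]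
    rw [e, norm_smul, norm_inv, Real.norm_of_nonneg (ht0 k).le, inv_mul_le_iff₀ (ht0 k), mul_comm]
    exact hyt k
  · rw [smul_smul, mul_inv_cancel₀ (ht0 k).ne', one_smul, add_sub_cancel]
    exact hy k

/-- Regular normals are nonpositive on tangents. -/
theorem normalCone_apply_nonpos {Z : Type*} [NormedAddCommGroup Z] [NormedSpace ℝ Z]
    {Ω : Set Z} {z v : Z} {zs : StrongDual ℝ Z} (hzs : zs ∈ normalCone Ω z)
    (hv : v ∈ posTangentConeAt Ω z) : zs v ≤ 0 := by
  obtain ⟨t, w, ht, ht0, hw, hmem⟩ := (mem_posTangentConeAt_iff_contingent hzs.1 v).1 hv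
  have hy : Tendsto (fun k => z + t k • w k) atTop (𝓝[Ω] z) :=
    tendsto_nhdsWithin_iff.2 ⟨by simpa using (ht0.smul hw).const_add z, Eventually.of_forall hmem⟩
  have key : ∀ ε > (0 : ℝ), zs v ≤ ε * ‖v‖ := by
    intro ε hε
    refine le_of_tendsto_of_tendsto ((zs.continuous.tendsto v).comp hw) (hw.norm.const_mul ε) ?_
    filter_upwards [hy.eventually (hzs.2 ε hε)] with k hk
    rw [add_sub_cancel_left, map_smul, norm_smul, Real.norm_of_nonneg (ht k).le, smul_eq_mul,
      mul_left_comm] at hk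
    exact le_of_mul_le_mul_left hk (ht k)
  have hlim : Tendsto (fun ε : ℝ => ε * ‖v‖) (𝓝[>] 0) (𝓝 0) :=
    ((continuous_id.mul continuous_const).tendsto' 0 0 (by simp)).mono_left nhdsWithin_le_nhds
  exact ge_of_tendsto hlim (eventually_mem_nhdsWithin.mono key)

/-- The first-order remainder along a ray. -/
theorem eventually_norm_ray_remainder_le {F G : Type*}
    [NormedAddCommGroup F] [NormedSpace ℝ F] [NormedAddCommGroup G] [NormedSpace ℝ G]
    {φ : F → G} {φ' : F →L[ℝ] G} {a : F} (hφ : HasFDerivAt φ φ' a) (v : F) {ε : ℝ} (hε : 0 < ε) :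
    ∀ᶠ t : ℝ in 𝓝[>] 0, ‖φ (a + t • v) - φ a - t • φ' v‖ ≤ ε * t := by
  have hray : Tendsto (fun t : ℝ => a + t • v) (𝓝[>] 0) (𝓝 a) :=
    ((continuous_const.add (continuous_id.smul continuous_const)).tendsto' 0 a
      (by simp)).mono_left nhdsWithin_le_nhds
  have hv : 0 < ‖v‖ + 1 := by positivity
  filter_upwards [hray.eventually ((hasFDerivAt_iff_isLittleO.1 hφ).def (div_pos hε hv)),
    eventually_mem_nhdsWithin] with t ht ht0
  have ht0' : (0 : ℝ) < t := ht0
  rw [add_sub_cancel_left, map_smul, norm_smul, Real.norm_of_nonneg ht0'.le] at ht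
  refine ht.trans ?_
  rw [div_mul_eq_mul_div, div_le_iff₀ hv]
  nlinarith [mul_pos hε ht0', norm_nonneg v]

/-! ### Sets reduced to a cone -/

section Reduction

variable {Y E : Type*} [NormedAddCommGroup Y] [NormedSpace ℝ Y]
    [NormedAddCommGroup E] [NormedSpace ℝ E]
    {C : Set Y} {K : ProperCone ℝ E} {h : Y → E} {y : Y}

theorem IsC2ConeReduction.contDiffAt (hC : IsC2ConeReduction C K h y) : ContDiffAt ℝ 2 h y := by
  obtain ⟨-, -, V, hV, hyV, hh, -⟩ := hC
  exact hh.contDiffAt (hV.mem_nhds hyV)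

theorem IsC2ConeReduction.map_eq_zero (hC : IsC2ConeReduction C K h y) : h y = 0 := by
  obtain ⟨-, -, V, hV, hyV, hh, h0, -⟩ := hC
  exact h0

theorem IsC2ConeReduction.surjective (hC : IsC2ConeReduction C K h y) :
    Function.Surjective (fderiv ℝ h y) := by
  obtain ⟨-, -, V, hV, hyV, hh, h0, hs, -⟩ := hC
  exact hs

theorem IsC2ConeReduction.eventually_mem_iff (hC : IsC2ConeReduction C K h y) :
    ∀ᶠ v in 𝓝 y, v ∈ C ↔ h v ∈ K := by
  obtain ⟨-, -, V, hV, hyV, hh, h0, hs, heq⟩ := hC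
  filter_upwards [hV.mem_nhds hyV] with v hv
  have := Set.ext_iff.1 heq v
  simpa [hv] using this

theorem IsC2ConeReduction.hasStrictFDerivAt (hC : IsC2ConeReduction C K h y) :
    HasStrictFDerivAt h (fderiv ℝ h y) y :=
  hC.contDiffAt.hasStrictFDerivAt (by norm_num)

/-- Near the reduction point, the distance to `C` is controlled by the distance of `h` to `K`. -/
theorem IsC2ConeReduction.exists_near [CompleteSpace Y] [CompleteSpace E]
    (hC : IsC2ConeReduction C K h y) :
    ∃ c > (0 : ℝ), ∀ᶠ ye in 𝓝 (y, (0 : E)), ye.2 ∈ K →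
      ∃ y' ∈ C, ‖y' - ye.1‖ ≤ c * ‖h ye.1 - ye.2‖ := by
  obtain ⟨c, hc, hev⟩ := exists_preimage_dist_le_of_surjective hC.hasStrictFDerivAt hC.surjective
  rw [hC.map_eq_zero] at hev
  refine ⟨c, hc, ?_⟩
  obtain ⟨δ, hδ, hball⟩ := Metric.eventually_nhds_iff_ball.1 hC.eventually_mem_iff
  -- This sum bounds `‖y' - y‖`; it keeps the corrected point where membership in `C` is tested by
  -- `h`.
  have h1 : Tendsto (fun ye : Y × E => c * ‖h ye.1 - ye.2‖ + ‖ye.1 - y‖) (𝓝 (y, 0)) (𝓝 0) := by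
    have e1 : Tendsto (fun ye : Y × E => h ye.1) (𝓝 (y, 0)) (𝓝 0) := by
      rw [← hC.map_eq_zero]
      exact (hC.contDiffAt.continuousAt.tendsto).comp (continuous_fst.tendsto' _ _ rfl)
    have e2 : Tendsto (fun ye : Y × E => ye.2) (𝓝 (y, 0)) (𝓝 0) := continuous_snd.tendsto' _ _ rfl
    have e3 : Tendsto (fun ye : Y × E => ye.1) (𝓝 (y, 0)) (𝓝 y) := continuous_fst.tendsto' _ _ rfl
    simpa using ((e1.sub e2).norm.const_mul c).add ((e3.sub_const y).norm)
  filter_upwards [hev, h1.eventually (gt_mem_nhds hδ)] with ye ⟨y', hy', hle⟩ hlt hK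
  refine ⟨y', (hball y' ?_).2 (hy' ▸ hK), hle⟩
  rw [Metric.mem_ball, dist_eq_norm]
  calc ‖y' - y‖ = ‖(y' - ye.1) + (ye.1 - y)‖ := by rw [sub_add_sub_cancel]
    _ ≤ _ := norm_add_le _ _
    _ < δ := by linarith

/-- The normals to a set which is reduced to the cone `K` by `h` at `y` are the images under
`∇h(y)*` of the polar of `K`. -/
theorem mem_normalCone_iff_of_isC2ConeReduction [CompleteSpace Y] [FiniteDimensional ℝ E]
    (hC : IsC2ConeReduction C K h y) (lam : StrongDual ℝ Y) :
    lam ∈ normalCone C y ↔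
      ∃ μ : StrongDual ℝ E, (∀ k ∈ K, μ k ≤ 0) ∧ μ.comp (fderiv ℝ h y) = lam := by
  have hyC : y ∈ C := hC.2.1
  have hd := hC.hasStrictFDerivAt.hasFDerivAt
  constructor
  · intro hlam
    have := FiniteDimensional.complete ℝ E
    -- Such `v` are tangent to `C`: the ray is corrected so that `h` takes the value `t ∇h v ∈ K`.
    -- Applied to `±v` in the kernel, this makes `lam` factor through `∇h`.
    have key : ∀ v, fderiv ℝ h y v ∈ K → lam v ≤ 0 := by
      intro v hv
      refine normalCone_apply_nonpos hlam (mem_posTangentConeAt_of_approx hyC fun ε hε => ?_)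
      obtain ⟨c, hc, hev⟩ := hC.exists_near
      have hT : Tendsto (fun t : ℝ => (y + t • v, t • fderiv ℝ h y v)) (𝓝[>] 0) (𝓝 (y, 0)) := by
        refine Tendsto.mono_left (Continuous.tendsto' ?_ _ _ (by simp)) nhdsWithin_le_nhds
        fun_prop
      filter_upwards [hT.eventually hev, eventually_mem_nhdsWithin,
        eventually_norm_ray_remainder_le hd v (div_pos hε hc)] with t ht ht0 hr
      obtain ⟨y', hy', hle⟩ := ht (K.smul_mem hv (le_of_lt ht0))
      refine ⟨y', hy', hle.trans ?_⟩
      rw [hC.map_eq_zero, sub_zero] at hr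
      calc c * ‖h (y + t • v) - t • fderiv ℝ h y v‖ ≤ c * (ε / c * t) := by gcongr
        _ = ε * t := by field_simp
    have hker : ∀ v, fderiv ℝ h y v = 0 → lam v = 0 := by
      intro v hv
      have h1 := key v (by rw [hv]; exact K.zero_mem)
      have h2 := key (-v) (by rw [map_neg, hv, neg_zero]; exact K.zero_mem)
      rw [map_neg] at h2
      linarith
    obtain ⟨L, hL⟩ := (fderiv ℝ h y).toLinearMap.exists_rightInverse_of_surjective
      (LinearMap.range_eq_top.2 hC.surjective)
    have hL' : ∀ e, fderiv ℝ h y (L e) = e := fun e => LinearMap.congr_fun hL e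
    refine ⟨(lam.toLinearMap ∘ₗ L).toContinuousLinearMap, fun k hk => ?_, ?_⟩
    · simpa using key (L k) (by rwa [hL'])
    · ext v
      have := hker (L (fderiv ℝ h y v) - v) (by rw [map_sub, hL', sub_self])
      rw [map_sub] at this
      simpa using sub_eq_zero.1 this
  · rintro ⟨μ, hμ, rfl⟩
    refine ⟨hyC, fun ε hε => ?_⟩
    have hpos : 0 < ‖μ‖ + 1 := by positivity
    filter_upwards [nhdsWithin_le_nhds hC.eventually_mem_iff, eventually_mem_nhdsWithin,
      nhdsWithin_le_nhds ((hasFDerivAt_iff_isLittleO.1 hd).def (div_pos hε hpos))] with v h1 h2 h3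
    have h4 := hμ _ (h1.1 h2)
    rw [hC.map_eq_zero, sub_zero] at h3
    have h5 : μ (fderiv ℝ h y (v - y)) = μ (h v) - μ (h v - fderiv ℝ h y (v - y)) := by
      rw [map_sub μ (h v)]; ring
    have h6 := (neg_le_abs _).trans (μ.le_opNorm (h v - fderiv ℝ h y (v - y)))
    have h7 : ‖μ‖ * ‖h v - fderiv ℝ h y (v - y)‖ ≤ (‖μ‖ + 1) * (ε / (‖μ‖ + 1) * ‖v - y‖) := by
      gcongr
      linarith
    have h8 : (‖μ‖ + 1) * (ε / (‖μ‖ + 1) * ‖v - y‖) = ε * ‖v - y‖ := by field_simp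
    change μ (fderiv ℝ h y (v - y)) ≤ _
    linarith

end Reduction

/-! ### Second-order quotients and proximal normals -/

/-- The second-order difference quotients of a map with the expansion
`q z = A (z - a) + ½ Q (z - a) (z - a) + o(‖z - a‖²)`. -/
theorem tendsto_second_order_quotient {F G ι : Type*}
    [NormedAddCommGroup F] [NormedSpace ℝ F] [NormedAddCommGroup G] [NormedSpace ℝ G]
    {q : F → G} {a : F} {A : F →L[ℝ] G} {Q : F →L[ℝ] F →L[ℝ] G}
    (hq : (fun z => q z - A (z - a) - (2⁻¹ : ℝ) • Q (z - a) (z - a)) =o[𝓝 a]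
      fun z => ‖z - a‖ ^ 2)
    {l : Filter ι} {t : ι → ℝ} {v : ι → F} {v₀ : F} (ht : Tendsto t l (𝓝 0))
    (ht0 : ∀ᶠ i in l, t i ≠ 0) (hv : Tendsto v l (𝓝 v₀)) :
    Tendsto (fun i => (t i ^ 2)⁻¹ • (q (a + t i • v i) - t i • A (v i))) l
      (𝓝 ((2⁻¹ : ℝ) • Q v₀ v₀)) := by
  have hz : Tendsto (fun i => a + t i • v i) l (𝓝 a) := by
    simpa using (ht.smul hv).const_add a
  have h1 := hq.comp_tendsto hz
  have h2 : Tendsto (fun i => (2⁻¹ : ℝ) • Q (v i) (v i)) l (𝓝 ((2⁻¹ : ℝ) • Q v₀ v₀)) := by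
    have hc : Continuous fun v => (2⁻¹ : ℝ) • Q v v := by fun_prop
    exact (hc.tendsto v₀).comp hv
  have h3 : Tendsto (fun i => (t i ^ 2)⁻¹ • (q (a + t i • v i) - t i • A (v i) -
      (t i ^ 2) • (2⁻¹ : ℝ) • Q (v i) (v i))) l (𝓝 0) := by
    have h4 : (fun i => q (a + t i • v i) - t i • A (v i) - (t i ^ 2) • (2⁻¹ : ℝ) • Q (v i) (v i))
        =o[l] fun i => t i ^ 2 := by
      have h5 : (fun i => ‖a + t i • v i - a‖ ^ 2) =O[l] fun i => t i ^ 2 := by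
        have h6 : (fun i => t i • v i) =O[l] fun i => t i := by
          simpa using (Asymptotics.isBigO_refl t l).smul (hv.isBigO_one ℝ)
        simpa using h6.norm_left.pow 2
      refine (h1.trans_isBigO h5).congr_left fun i => ?_
      simp only [Function.comp, add_sub_cancel_left, map_smul, smul_apply]
      congr 1
      module
    exact h4.tendsto_inv_smul_nhds_zero
  have h7 := h3.add h2
  rw [zero_add] at h7
  refine h7.congr' ?_
  filter_upwards [ht0] with i hi
  rw [smul_sub _ (_ - _), smul_smul ((t i ^ 2)⁻¹), inv_mul_cancel₀ (pow_ne_zero 2 hi), one_smul]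
  abel

/-- A minimizer over `S` of `R ‖x - c‖² - l x` produces a regular normal. -/
theorem mem_normalCone_of_isMin {X : Type*} [NormedAddCommGroup X] [InnerProductSpace ℝ X]
    {S : Set X} {x₀ c : X} {R : ℝ} {l : StrongDual ℝ X} (hx₀ : x₀ ∈ S)
    (hmin : ∀ᶠ x in 𝓝[S] x₀, R * ‖x₀ - c‖ ^ 2 - l x₀ ≤ R * ‖x - c‖ ^ 2 - l x) :
    l - (2 * R) • innerSL ℝ (x₀ - c) ∈ normalCone S x₀ := by
  refine ⟨hx₀, fun ε hε => ?_⟩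
  -- After expanding the square, the leftover `R ‖x - x₀‖²` is absorbed by `ε ‖x - x₀‖`.
  have h1 : ∀ᶠ x in 𝓝[S] x₀, R * ‖x - x₀‖ < ε := by
    refine nhdsWithin_le_nhds (Tendsto.eventually_lt_const hε ?_)
    exact Continuous.tendsto' (by fun_prop) _ _ (by simp)
  filter_upwards [hmin, h1] with x hx hx1
  have e1 : x - c = (x₀ - c) + (x - x₀) := by abel
  rw [e1, norm_add_sq_real] at hx
  simp only [sub_apply, smul_apply, innerSL_apply_apply, smul_eq_mul, map_sub l]
  nlinarith [norm_nonneg (x - x₀), mul_le_mul_of_nonneg_right hx1.le (norm_nonneg (x - x₀))]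

/-! ### Feasible arcs of second order -/

section Core

variable {P X E : Type*}
  [NormedAddCommGroup P] [NormedSpace ℝ P]
  [NormedAddCommGroup X] [InnerProductSpace ℝ X]
  [NormedAddCommGroup E] [NormedSpace ℝ E]
  {Ω : Set (P × X)} {K : ProperCone ℝ E} {q : P × X → E} {zb : P × X}
  {A : P × X →L[ℝ] E} {Q : P × X →L[ℝ] P × X →L[ℝ] E} {μ : StrongDual ℝ E} {u : X}

/-- Feasible arcs in the direction `(0, u)` along which the first-order form attains the value
given by the multiplier maximizing the curvature term. -/
theorem exists_second_order_feasible
    (hq : (fun z => q z - A (z - zb) - (2⁻¹ : ℝ) • Q (z - zb) (z - zb)) =o[𝓝 zb]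
      fun z => ‖z - zb‖ ^ 2)
    {κ : ℝ} (hκ : 0 < κ)
    (hRS : ∀ᶠ ze in 𝓝 (zb, (0 : E)), ze.2 ∈ K →
      ∃ x', (ze.1.1, x') ∈ Ω ∧ ‖x' - ze.1.2‖ ≤ κ * ‖q ze.1 - ze.2‖)
    (hμ : ∀ k ∈ K, μ k ≤ 0)
    (hmax : ∀ μ' : StrongDual ℝ E, (∀ k ∈ K, μ' k ≤ 0) → μ'.comp A = μ.comp A →
      μ' (Q (0, u) (0, u)) ≤ μ (Q (0, u) (0, u)))
    (huK : A (0, u) ∈ K) (hu0 : μ (A (0, u)) = 0) {ε : ℝ} (hε : 0 < ε) :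
    ∀ᶠ t : ℝ in 𝓝[>] 0, ∃ z ∈ Ω, ‖z - zb - t • ((0 : P), u)‖ ≤ ε * t ∧
      ‖z.1 - zb.1‖ ^ 2 ≤ ε * t ^ 3 ∧
      -μ (A (z - zb)) ≤ t ^ 2 * (2⁻¹ * μ (Q (0, u) (0, u)) + ε) := by
  set v : P × X := (0, u) with hv
  have hc0 : 0 < 1 + ‖μ.comp A‖ * κ := by positivity
  -- The dual solution costs `η`, the Robinson correction `‖μ A‖ κ η`; together they make `ε`.
  set η := ε / (1 + ‖μ.comp A‖ * κ) with hη
  have hη0 : 0 < η := div_pos hε hc0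
  have hηe : η * (1 + ‖μ.comp A‖ * κ) = ε := div_mul_cancel₀ _ hc0.ne'
  obtain ⟨w, k, hk, hwk, hwm⟩ := exists_approx_dual_solution K A (Q v v) μ hμ hmax hη0
  have hid : Tendsto (fun t : ℝ => t) (𝓝[>] 0) (𝓝 0) := tendsto_id.mono_left nhdsWithin_le_nhds
  have hpos : ∀ᶠ t : ℝ in 𝓝[>] 0, 0 < t := eventually_mem_nhdsWithin
  have hvt : Tendsto (fun t : ℝ => v + (t / 2) • w) (𝓝[>] 0) (𝓝 v) := by
    refine (Continuous.tendsto' ?_ 0 v (by simp)).mono_left nhdsWithin_le_nhds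
    fun_prop
  have hquot := tendsto_second_order_quotient hq hid (hpos.mono fun t ht => ht.ne') hvt
  -- Along the arc `zb + t v + (t²/2) w`, `q` equals `t A v + (t²/2)(Q v v + A w) + o(t²)`, which is
  -- close to `t A v + (t²/2) k ∈ K`. Robinson stability corrects only `x`, so the parameter stays
  -- displaced by exactly `(t²/2) w.1`.
  have hrem : ∀ᶠ t : ℝ in 𝓝[>] 0,
      ‖q (zb + t • (v + (t / 2) • w)) - (t • A v + (t ^ 2 / 2) • k)‖ ≤ η * t ^ 2 := by
    have h1 := (hquot.add_const ((2⁻¹ : ℝ) • (A w - k))).norm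
    have h2 : ‖(2⁻¹ : ℝ) • Q v v + (2⁻¹ : ℝ) • (A w - k)‖ < η := by
      rw [← smul_add, norm_smul, ← add_sub_assoc, Real.norm_of_nonneg (by norm_num)]
      linarith [norm_nonneg (Q v v + A w - k)]
    filter_upwards [h1.eventually_lt_const h2, hpos] with t ht ht0
    have e1 : q (zb + t • (v + (t / 2) • w)) - (t • A v + (t ^ 2 / 2) • k) =
        t ^ 2 • ((t ^ 2)⁻¹ • (q (zb + t • (v + (t / 2) • w)) - t • A (v + (t / 2) • w)) +
          (2⁻¹ : ℝ) • (A w - k)) := by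
      rw [smul_add (t ^ 2), smul_smul (t ^ 2), mul_inv_cancel₀ (by positivity), one_smul, map_add A,
        map_smul A]
      module
    rw [e1, norm_smul, Real.norm_of_nonneg (by positivity), mul_comm]
    gcongr
  have harc : Tendsto (fun t : ℝ => (zb + t • (v + (t / 2) • w), t • A v + (t ^ 2 / 2) • k))
      (𝓝[>] 0) (𝓝 (zb, 0)) := by
    refine (Continuous.tendsto' ?_ 0 (zb, 0) (by simp)).mono_left nhdsWithin_le_nhds
    fun_prop
  have hs1 : ∀ᶠ t : ℝ in 𝓝[>] 0, t * ‖w‖ + κ * η * t < ε := by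
    refine Tendsto.eventually_lt_const hε ?_
    exact (Continuous.tendsto' (by fun_prop) 0 0 (by simp)).mono_left nhdsWithin_le_nhds
  have hs2 : ∀ᶠ t : ℝ in 𝓝[>] 0, t * ‖w‖ ^ 2 < ε := by
    refine Tendsto.eventually_lt_const hε ?_
    exact (Continuous.tendsto' (by fun_prop) 0 0 (by simp)).mono_left nhdsWithin_le_nhds
  filter_upwards [harc.eventually hRS, hrem, hs1, hs2, hpos] with t hRSt hremt hs1t hs2t ht
  obtain ⟨x', hx', hle⟩ := hRSt (K.add_mem (K.smul_mem huK ht.le) (K.smul_mem hk (by positivity)))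
  set z₀ := zb + t • (v + (t / 2) • w) with hz₀
  have hle' : ‖x' - z₀.2‖ ≤ κ * (η * t ^ 2) := hle.trans (by gcongr)
  have hz1 : z₀.1 = zb.1 + (t ^ 2 / 2) • w.1 := by
    simp only [hz₀, hv, Prod.fst_add, Prod.smul_fst, zero_add, smul_smul]
    congr 2
    ring
  have e2 : (z₀.1, x') - zb = t • v + (t ^ 2 / 2) • w + ((0 : P), x' - z₀.2) := by
    have : (z₀.1, x') = z₀ + ((0 : P), x' - z₀.2) := by ext <;> simp
    rw [this, hz₀]
    module
  have hn0 : ‖((0 : P), x' - z₀.2)‖ ≤ κ * (η * t ^ 2) := by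
    rw [Prod.norm_def]
    simpa using hle'
  refine ⟨(z₀.1, x'), hx', ?_, ?_, ?_⟩
  · rw [e2, add_assoc, add_sub_cancel_left]
    refine (norm_add_le _ _).trans ?_
    rw [norm_smul, Real.norm_of_nonneg (by positivity)]
    nlinarith [norm_nonneg w, mul_nonneg (norm_nonneg w) (sq_nonneg t)]
  · have hw1 : ‖w.1‖ ≤ ‖w‖ := norm_fst_le w
    simp only [hz1, add_sub_cancel_left, norm_smul]
    rw [Real.norm_of_nonneg (by positivity), mul_pow]
    have h3 : ‖w.1‖ ^ 2 ≤ ‖w‖ ^ 2 := by gcongr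
    have h4 : (t ^ 2 / 2) ^ 2 * ‖w.1‖ ^ 2 ≤ t ^ 3 * (t * ‖w‖ ^ 2) := by
      have : (t ^ 2 / 2) ^ 2 * ‖w.1‖ ^ 2 ≤ (t ^ 2 / 2) ^ 2 * ‖w‖ ^ 2 := by gcongr
      nlinarith [mul_nonneg (sq_nonneg ‖w‖) (sq_nonneg (t ^ 2))]
    have : t ^ 3 * (t * ‖w‖ ^ 2) ≤ t ^ 3 * ε := by gcongr
    linarith
  · rw [e2]
    simp only [map_add, map_smul, hu0, smul_eq_mul, mul_zero, zero_add]
    have h5 := ((neg_le_abs _).trans ((μ.comp A).le_opNorm ((0 : P), x' - z₀.2))).trans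
      (mul_le_mul_of_nonneg_left hn0 (norm_nonneg _))
    simp only [ContinuousLinearMap.comp_apply] at h5
    have h6 : t ^ 2 * ε = t ^ 2 * η + ‖μ.comp A‖ * (κ * (η * t ^ 2)) := by
      rw [← hηe]; ring
    have h7 : t ^ 2 / 2 * (-μ (A w)) ≤ t ^ 2 / 2 * (μ (Q v v) + η) := by gcongr
    nlinarith [mul_pos hη0 (pow_pos ht 2)]

end Core

/-- The quadratic form of a bounded bilinear map is bounded. -/
theorem exists_bilinear_diagonal_bound {F G : Type*}
    [NormedAddCommGroup F] [NormedSpace ℝ F] [NormedAddCommGroup G] [NormedSpace ℝ G]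
    (Q : F →L[ℝ] F →L[ℝ] G) : ∃ b ≥ (0 : ℝ), ∀ v, ‖Q v v‖ ≤ b * ‖v‖ ^ 2 :=
  ⟨‖Q‖, norm_nonneg Q, fun v => by simpa [pow_two, mul_assoc] using Q.le_opNorm₂ v v⟩

/-! ### Bounds for the penalty function -/

section Core

variable {P X E : Type*}
  [NormedAddCommGroup P] [NormedSpace ℝ P]
  [NormedAddCommGroup X] [InnerProductSpace ℝ X]
  [NormedAddCommGroup E] [NormedSpace ℝ E]
  {Ω : Set (P × X)} {K : ProperCone ℝ E} {q : P × X → E} {zb : P × X}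
  {A : P × X →L[ℝ] E} {Q : P × X →L[ℝ] P × X →L[ℝ] E} {μ : StrongDual ℝ E} {u : X}

/-- The penalty function whose minimizers over `Ω` follow the direction `(0, u)`. -/
noncomputable def penalty (zb : P × X) (A : P × X →L[ℝ] E) (μ : StrongDual ℝ E) (u : X)
    (w : StrongDual ℝ X) (R t : ℝ) (z : P × X) : ℝ :=
  ‖z.1 - zb.1‖ ^ 2 / t + R * ‖z.2 - (zb.2 + t • u)‖ ^ 2 - μ (A (z - zb)) - t * w (z.2 - zb.2)

/-- Upper estimate of the penalty function along feasible arcs. -/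
theorem exists_penalty_le
    (hq : (fun z => q z - A (z - zb) - (2⁻¹ : ℝ) • Q (z - zb) (z - zb)) =o[𝓝 zb]
      fun z => ‖z - zb‖ ^ 2)
    {κ : ℝ} (hκ : 0 < κ)
    (hRS : ∀ᶠ ze in 𝓝 (zb, (0 : E)), ze.2 ∈ K →
      ∃ x', (ze.1.1, x') ∈ Ω ∧ ‖x' - ze.1.2‖ ≤ κ * ‖q ze.1 - ze.2‖)
    (hμ : ∀ k ∈ K, μ k ≤ 0)
    (hmax : ∀ μ' : StrongDual ℝ E, (∀ k ∈ K, μ' k ≤ 0) → μ'.comp A = μ.comp A →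
      μ' (Q (0, u) (0, u)) ≤ μ (Q (0, u) (0, u)))
    (huK : A (0, u) ∈ K) (hu0 : μ (A (0, u)) = 0) (w : StrongDual ℝ X) {R : ℝ} (hR : 0 ≤ R)
    {δ : ℝ} (hδ : 0 < δ) {ε : ℝ} (hε : 0 < ε) :
    ∀ᶠ t : ℝ in 𝓝[>] 0, ∃ z ∈ Ω ∩ Metric.closedBall zb δ,
      penalty zb A μ u w R t z ≤ t ^ 2 * (2⁻¹ * μ (Q (0, u) (0, u)) - w u + ε) := by
  have hc0 : 0 < R + ‖w‖ + 2 := by positivity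
  -- The four penalty terms contribute errors `η`, `R η`, `η` and `‖w‖ η`, in units of `t²`; `η ≤ 1`
  -- gives `(η t)² ≤ η t²`.
  set η := min 1 (ε / (R + ‖w‖ + 2)) with hη
  have hη0 : 0 < η := lt_min one_pos (div_pos hε hc0)
  have hη1 : η ≤ 1 := min_le_left _ _
  have hηe : η * (R + ‖w‖ + 2) ≤ ε := by
    rw [← le_div_iff₀ hc0]
    exact min_le_right _ _
  have hs : ∀ᶠ t : ℝ in 𝓝[>] 0, t * ‖u‖ + t < δ := by
    refine Tendsto.eventually_lt_const hδ ?_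
    exact (Continuous.tendsto' (by fun_prop) 0 0 (by simp)).mono_left nhdsWithin_le_nhds
  filter_upwards [exists_second_order_feasible hq hκ hRS hμ hmax huK hu0 hη0, hs,
    eventually_mem_nhdsWithin] with t ⟨z, hz, h1, h2, h3⟩ hst ht
  have ht' : 0 < t := ht
  have hball : z ∈ Metric.closedBall zb δ := by
    rw [Metric.mem_closedBall, dist_eq_norm]
    have e : z - zb = (z - zb - t • ((0 : P), u)) + t • ((0 : P), u) := by abel
    rw [e]
    refine (norm_add_le _ _).trans ?_
    have : ‖t • ((0 : P), u)‖ = t * ‖u‖ := by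
      rw [norm_smul, Real.norm_of_nonneg ht'.le, Prod.norm_def]
      simp
    rw [this]
    nlinarith
  refine ⟨z, ⟨hz, hball⟩, ?_⟩
  have h4 : ‖z.2 - (zb.2 + t • u)‖ ≤ η * t := by
    refine le_trans ?_ h1
    have := norm_snd_le (z - zb - t • ((0 : P), u))
    simpa [sub_sub] using this
  have h5 : ‖z.1 - zb.1‖ ^ 2 / t ≤ η * t ^ 2 := by
    rw [div_le_iff₀ ht']
    linarith [pow_succ t 2]
  have h6 : R * ‖z.2 - (zb.2 + t • u)‖ ^ 2 ≤ R * (η * t ^ 2) := by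
    have : ‖z.2 - (zb.2 + t • u)‖ ^ 2 ≤ (η * t) ^ 2 := by gcongr
    have : (η * t) ^ 2 ≤ η * t ^ 2 := by nlinarith [sq_nonneg t, mul_nonneg hη0.le (sq_nonneg t)]
    gcongr
    linarith
  have h7 : -(t * w (z.2 - zb.2)) ≤ -(t ^ 2 * w u) + ‖w‖ * (η * t ^ 2) := by
    have e : z.2 - zb.2 = (z.2 - (zb.2 + t • u)) + t • u := by abel
    have h8 := (neg_le_abs _).trans (w.le_opNorm (z.2 - (zb.2 + t • u)))
    have h9 : ‖w‖ * ‖z.2 - (zb.2 + t • u)‖ ≤ ‖w‖ * (η * t) := by gcongr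
    rw [e, map_add, map_smul, smul_eq_mul]
    nlinarith
  have h10 : t ^ 2 * (η * (R + ‖w‖ + 2)) ≤ t ^ 2 * ε := by gcongr
  unfold penalty
  linarith

/-- On `Ω`, the first-order form grows at most quadratically. -/
theorem exists_quadratic_lower_bound
    (hq : (fun z => q z - A (z - zb) - (2⁻¹ : ℝ) • Q (z - zb) (z - zb)) =o[𝓝 zb]
      fun z => ‖z - zb‖ ^ 2)
    (hΩK : ∀ᶠ z in 𝓝 zb, z ∈ Ω → q z ∈ K) (hμ : ∀ k ∈ K, μ k ≤ 0) :
    ∃ β ≥ (0 : ℝ), ∃ δ > 0, ∀ z ∈ Ω ∩ Metric.closedBall zb δ, q z ∈ K ∧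
      -(β * ‖z - zb‖ ^ 2) ≤ -μ (A (z - zb)) := by
  obtain ⟨b, hb0, hb⟩ := exists_bilinear_diagonal_bound Q
  set β := ‖μ‖ * (1 + b) with hβ
  obtain ⟨δ, hδ, hball⟩ := Metric.eventually_nhds_iff_ball.1 (hΩK.and (hq.def one_pos))
  refine ⟨β, by positivity, δ / 2, by linarith, ?_⟩
  rintro z ⟨hz, hzb⟩
  have hz' : z ∈ Metric.ball zb δ := Metric.closedBall_subset_ball (by linarith) hzb
  obtain ⟨h1, h2⟩ := hball z hz'
  refine ⟨h1 hz, ?_⟩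
  -- Since `μ (q z) ≤ 0`, only the second-order part of `q` can make `μ (A (z - zb))` positive.
  have h3 := hμ _ (h1 hz)
  set r := q z - A (z - zb) - (2⁻¹ : ℝ) • Q (z - zb) (z - zb) with hr
  have e : A (z - zb) = q z - (r + (2⁻¹ : ℝ) • Q (z - zb) (z - zb)) := by rw [hr]; abel
  rw [norm_pow, norm_norm, one_mul] at h2
  have h4 : ‖r + (2⁻¹ : ℝ) • Q (z - zb) (z - zb)‖ ≤ (1 + b) * ‖z - zb‖ ^ 2 := by
    refine (norm_add_le _ _).trans ?_
    rw [norm_smul, Real.norm_of_nonneg (by norm_num)]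
    linarith [hb (z - zb), norm_nonneg (Q (z - zb) (z - zb))]
  have h5 := (neg_le_abs _).trans (μ.le_opNorm (r + (2⁻¹ : ℝ) • Q (z - zb) (z - zb)))
  have h6 : ‖μ‖ * ‖r + (2⁻¹ : ℝ) • Q (z - zb) (z - zb)‖ ≤ ‖μ‖ * ((1 + b) * ‖z - zb‖ ^ 2) := by
    gcongr
  rw [e, map_sub, hβ]
  linarith

/-- Coercivity of the penalty function on `Ω`, uniformly in `t`. -/
theorem exists_penalty_coercive
    (hq : (fun z => q z - A (z - zb) - (2⁻¹ : ℝ) • Q (z - zb) (z - zb)) =o[𝓝 zb]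
      fun z => ‖z - zb‖ ^ 2)
    (hΩK : ∀ᶠ z in 𝓝 zb, z ∈ Ω → q z ∈ K) (hμ : ∀ k ∈ K, μ k ≤ 0) (w : StrongDual ℝ X) (c : ℝ) :
    ∃ R₀ : ℝ, ∀ R ≥ R₀, ∃ c' > 0, ∃ δ₀ > 0, ∀ᶠ t : ℝ in 𝓝[>] 0,
      ∀ z ∈ Ω ∩ Metric.closedBall zb δ₀, penalty zb A μ u w R t z ≤ c * t ^ 2 →
        ‖z.1 - zb.1‖ ^ 2 ≤ c' * t ^ 3 ∧ ‖z.2 - (zb.2 + t • u)‖ ^ 2 ≤ c' * t ^ 2 ∧ q z ∈ K := by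
  obtain ⟨β, hβ0, δ, hδ, hlow⟩ := exists_quadratic_lower_bound hq hΩK hμ
  -- With `a = ‖z.2 - (zb.2 + t u)‖`, the curvature consumes `2 β a²` and the `w`-term one `a²`; one
  -- `a²` remains for coercivity. The parameter term `β p²` is absorbed by half of `p² / t` once `t
  -- (2 β + 2) < 1`.
  refine ⟨2 * β + 2, fun R hR => ?_⟩
  set c₂ := |c| + 2 * β * ‖u‖ ^ 2 + ‖w‖ ^ 2 + ‖w‖ * ‖u‖ + 1 with hc₂
  refine ⟨2 * c₂, by positivity, δ, hδ, ?_⟩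
  have hs : ∀ᶠ t : ℝ in 𝓝[>] 0, t * (2 * β + 2) < 1 := by
    refine Tendsto.eventually_lt_const one_pos ?_
    exact (Continuous.tendsto' (by fun_prop) 0 0 (by simp)).mono_left nhdsWithin_le_nhds
  filter_upwards [hs, eventually_mem_nhdsWithin] with t hst ht z hz hpen
  have ht' : 0 < t := ht
  obtain ⟨hK, hA⟩ := hlow z hz
  unfold penalty at hpen
  set p := ‖z.1 - zb.1‖ with hp
  set a := ‖z.2 - (zb.2 + t • u)‖ with ha
  have hx : ‖z.2 - zb.2‖ ≤ a + t * ‖u‖ := by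
    have e : z.2 - zb.2 = (z.2 - (zb.2 + t • u)) + t • u := by abel
    rw [e]
    refine (norm_add_le _ _).trans ?_
    rw [norm_smul, Real.norm_of_nonneg ht'.le]
  have hx2 : ‖z.2 - zb.2‖ ^ 2 ≤ 2 * a ^ 2 + 2 * t ^ 2 * ‖u‖ ^ 2 := by
    have : ‖z.2 - zb.2‖ ^ 2 ≤ (a + t * ‖u‖) ^ 2 := by gcongr
    nlinarith [sq_nonneg (a - t * ‖u‖)]
  have hzn : ‖z - zb‖ ^ 2 ≤ p ^ 2 + ‖z.2 - zb.2‖ ^ 2 := by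
    rw [Prod.norm_def]
    rcases max_cases ‖(z - zb).1‖ ‖(z - zb).2‖ with h | h <;> rw [h.1] <;>
      simp only [Prod.fst_sub, Prod.snd_sub] <;> nlinarith [sq_nonneg p, sq_nonneg ‖z.2 - zb.2‖]
  have hw : t * w (z.2 - zb.2) ≤ a ^ 2 + t ^ 2 * ‖w‖ ^ 2 + t ^ 2 * (‖w‖ * ‖u‖) := by
    have h1 := (le_abs_self _).trans (w.le_opNorm (z.2 - zb.2))
    have h2 : ‖w‖ * ‖z.2 - zb.2‖ ≤ ‖w‖ * (a + t * ‖u‖) := by gcongr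
    have h3 : t * w (z.2 - zb.2) ≤ t * (‖w‖ * (a + t * ‖u‖)) := by
      gcongr
      exact h1.trans h2
    nlinarith [sq_nonneg (a - t * ‖w‖), sq_nonneg (t * ‖w‖)]
  have hβz : β * ‖z - zb‖ ^ 2 ≤ β * (p ^ 2 + (2 * a ^ 2 + 2 * t ^ 2 * ‖u‖ ^ 2)) := by
    gcongr
    linarith
  have hRa : (2 * β + 2) * a ^ 2 ≤ R * a ^ 2 := by gcongr
  have hpt : (2 * β + 2) * p ^ 2 ≤ p ^ 2 / t := by
    rw [le_div_iff₀ ht']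
    nlinarith [sq_nonneg p]
  have hct : c * t ^ 2 ≤ |c| * t ^ 2 := by
    gcongr
    exact le_abs_self c
  have hsum : p ^ 2 / t - β * p ^ 2 + a ^ 2 ≤ (c₂ - 1) * t ^ 2 := by
    rw [hc₂]
    linarith
  have hc₂0 : 1 ≤ c₂ := by
    rw [hc₂]
    have : 0 ≤ |c| + 2 * β * ‖u‖ ^ 2 + ‖w‖ ^ 2 + ‖w‖ * ‖u‖ := by positivity
    linarith
  have ht2 : 0 < t ^ 2 := by positivity
  refine ⟨?_, by nlinarith [sq_nonneg p], hK⟩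
  have h8 : p ^ 2 / t ≤ 2 * c₂ * t ^ 2 := by nlinarith [sq_nonneg p, sq_nonneg a]
  rw [div_le_iff₀ ht'] at h8
  linarith [pow_succ t 2]

end Core

/-! ### Tangents to the graph of the partial normal cone mapping -/

section Core

variable {P X E : Type*}
  [NormedAddCommGroup P] [NormedSpace ℝ P]
  [NormedAddCommGroup X] [InnerProductSpace ℝ X]
  [NormedAddCommGroup E] [NormedSpace ℝ E]
  {Ω : Set (P × X)} {K : ProperCone ℝ E} {q : P × X → E} {zb : P × X}
  {A : P × X →L[ℝ] E} {Q : P × X →L[ℝ] P × X →L[ℝ] E} {μ : StrongDual ℝ E} {u : X}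

/-- Minimizers of the penalty function have partial regular normals which are perturbations of the
first-order form. -/
theorem penalty_isMinOn_normal {w : StrongDual ℝ X} {R t δ : ℝ} {z : P × X}
    (hz : z ∈ Ω) (hzδ : z ∈ Metric.ball zb δ)
    (hmin : IsMinOn (penalty zb A μ u w R t) (Ω ∩ Metric.closedBall zb δ) z) :
    (μ.comp A).comp (ContinuousLinearMap.inr ℝ P X) + t • w -
      (2 * R) • innerSL ℝ (z.2 - (zb.2 + t • u)) ∈ normalCone {x | (z.1, x) ∈ Ω} z.2 := by
  -- With the parameter frozen at `z.1`, the penalty is `R ‖x - c‖² - l x` up to a constant.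
  refine mem_normalCone_of_isMin hz ?_
  have hcont : Tendsto (fun x : X => (z.1, x)) (𝓝 z.2) (𝓝 z) :=
    Continuous.tendsto' (by fun_prop) _ _ rfl
  filter_upwards [nhdsWithin_le_nhds (hcont.eventually (Metric.isOpen_ball.mem_nhds hzδ)),
    eventually_mem_nhdsWithin] with x hx hxΩ
  have h := isMinOn_iff.1 hmin (z.1, x) ⟨hxΩ, Metric.ball_subset_closedBall hx⟩
  unfold penalty at h
  have e1 : ∀ y : X, μ (A ((z.1, y) - zb)) = μ (A (0, y)) + μ (A ((z.1, 0) - zb)) := by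
    intro y
    rw [← map_add, ← map_add]
    congr 2
    ext <;> simp
    abel
  have e2 := e1 x
  have e3 := e1 z.2
  simp only [add_apply, ContinuousLinearMap.comp_apply, smul_apply, smul_eq_mul,
    ContinuousLinearMap.inr_apply]
  simp only [map_sub w, Prod.mk.eta] at h e3
  linarith

/-- If the multiplier `μ` maximizes the curvature term in direction `(0, u)` and the element `n` is
normal at `u` to the critical cone, then `(0, u, Q*μ (0, u) + n)` is tangent to the graph of the
partial normal cone mapping of `Ω`. -/
theorem exists_normals_in_direction [FiniteDimensional ℝ P] [FiniteDimensional ℝ X]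
    (hzb : zb ∈ Ω) {δ₁ : ℝ} (hδ₁ : 0 < δ₁) (hclosed : IsClosed (Ω ∩ Metric.closedBall zb δ₁))
    (hq : (fun z => q z - A (z - zb) - (2⁻¹ : ℝ) • Q (z - zb) (z - zb)) =o[𝓝 zb]
      fun z => ‖z - zb‖ ^ 2)
    (hsymm : ∀ v w, Q v w = Q w v)
    (hΩK : ∀ᶠ z in 𝓝 zb, z ∈ Ω → q z ∈ K)
    {κ : ℝ} (hκ : 0 < κ)
    (hRS : ∀ᶠ ze in 𝓝 (zb, (0 : E)), ze.2 ∈ K →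
      ∃ x', (ze.1.1, x') ∈ Ω ∧ ‖x' - ze.1.2‖ ≤ κ * ‖q ze.1 - ze.2‖)
    (hμ : ∀ k ∈ K, μ k ≤ 0)
    (hmax : ∀ μ' : StrongDual ℝ E, (∀ k ∈ K, μ' k ≤ 0) → μ'.comp A = μ.comp A →
      μ' (Q (0, u) (0, u)) ≤ μ (Q (0, u) (0, u)))
    (huK : A (0, u) ∈ K) (hu0 : μ (A (0, u)) = 0)
    {w : StrongDual ℝ X}
    (hn : ∀ ξ : X, A (0, ξ) ∈ K → μ (A (0, ξ)) = 0 → w ξ ≤ μ (Q (0, u) (0, ξ)))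
    (hnu : μ (Q (0, u) (0, u)) ≤ w u) :
    ∃ (t : ℕ → ℝ) (z : ℕ → P × X) (xs : ℕ → StrongDual ℝ X), (∀ k, 0 < t k) ∧
      Tendsto t atTop (𝓝 0) ∧ Tendsto (fun k => (t k)⁻¹ • (z k - zb)) atTop (𝓝 (0, u)) ∧
      (∀ᶠ k in atTop, xs k ∈ normalCone {x | ((z k).1, x) ∈ Ω} (z k).2) ∧
      Tendsto (fun k => (t k)⁻¹ •
        (xs k - (μ.comp A).comp (ContinuousLinearMap.inr ℝ P X))) atTop (𝓝 w) := by
  set m := μ (Q (0, u) (0, u)) with hm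
  set c : ℝ := 2⁻¹ * m - w u + 1 with hc
  obtain ⟨b, hb0, hb⟩ := exists_bilinear_diagonal_bound Q
  obtain ⟨R₀, hR₀⟩ := exists_penalty_coercive (u := u) hq hΩK hμ w c
  -- `R` exceeds both the coercivity threshold and the bound `‖μ‖ b` on the curvature form; the
  -- latter identifies the limit direction.
  set R := max R₀ (‖μ‖ * b + 1) with hR
  have hR1 : ‖μ‖ * b + 1 ≤ R := le_max_right _ _
  have hRpos : 0 < R := lt_of_lt_of_le (by positivity) hR1
  obtain ⟨c', hc', δ₀, hδ₀, hcoer⟩ := hR₀ R (le_max_left _ _)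
  set δ := min δ₀ δ₁ with hδ
  have hδpos : 0 < δ := lt_min hδ₀ hδ₁
  set S := Ω ∩ Metric.closedBall zb δ with hS
  have hSsub : S ⊆ Ω ∩ Metric.closedBall zb δ₀ := fun z hz =>
    ⟨hz.1, Metric.closedBall_subset_closedBall (min_le_left _ _) hz.2⟩
  have hcomp : IsCompact S := by
    have e : S = (Ω ∩ Metric.closedBall zb δ₁) ∩ Metric.closedBall zb δ := by
      rw [hS, inter_assoc, inter_eq_self_of_subset_right
        (Metric.closedBall_subset_closedBall (min_le_right _ _))]
    rw [e]
    exact (isCompact_closedBall zb δ).inter_left hclosed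
  have hex : ∀ t : ℝ, ∃ z ∈ S, IsMinOn (penalty zb A μ u w R t) S z := fun t =>
    hcomp.exists_isMinOn ⟨zb, hzb, Metric.mem_closedBall_self hδpos.le⟩
      (by unfold penalty; fun_prop)
  choose Z hZS hZmin using hex
  have hpos : ∀ᶠ t : ℝ in 𝓝[>] 0, 0 < t := eventually_mem_nhdsWithin
  have hup : ∀ ε > 0, ∀ᶠ t : ℝ in 𝓝[>] 0,
      penalty zb A μ u w R t (Z t) ≤ t ^ 2 * (2⁻¹ * m - w u + ε) := by
    intro ε hε
    filter_upwards [exists_penalty_le hq hκ hRS hμ hmax huK hu0 w hRpos.le hδpos hε] with t ht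
    obtain ⟨z, hz, hle⟩ := ht
    exact (isMinOn_iff.1 (hZmin t) z hz).trans hle
  have hgood : ∀ᶠ t : ℝ in 𝓝[>] 0, ‖(Z t).1 - zb.1‖ ^ 2 ≤ c' * t ^ 3 ∧
      ‖(Z t).2 - (zb.2 + t • u)‖ ^ 2 ≤ c' * t ^ 2 ∧ q (Z t) ∈ K := by
    filter_upwards [hcoer, hup 1 one_pos] with t ht h1
    exact ht _ (hSsub (hZS t)) (h1.trans_eq (mul_comm _ _))
  -- From `‖p - p̄‖² ≤ c' t³` the quotient is at most `√(c' t)`.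
  have hπ : Tendsto (fun t : ℝ => t⁻¹ • ((Z t).1 - zb.1)) (𝓝[>] 0) (𝓝 0) := by
    rw [tendsto_zero_iff_norm_tendsto_zero]
    have h1 : Tendsto (fun t : ℝ => √(c' * t)) (𝓝[>] 0) (𝓝 0) :=
      (Continuous.tendsto' (by fun_prop) 0 0 (by simp)).mono_left nhdsWithin_le_nhds
    refine squeeze_zero' (Eventually.of_forall fun _ => norm_nonneg _) ?_ h1
    filter_upwards [hgood, hpos] with t ht ht0
    refine Real.le_sqrt_of_sq_le ?_
    rw [norm_smul, norm_inv, Real.norm_of_nonneg ht0.le, mul_pow, inv_pow,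
      inv_mul_le_iff₀ (by positivity)]
    linarith [ht.1]
  have hξ : ∀ᶠ t : ℝ in 𝓝[>] 0, t⁻¹ • ((Z t).2 - zb.2) ∈ Metric.closedBall u √c' := by
    filter_upwards [hgood, hpos] with t ht ht0
    rw [Metric.mem_closedBall, dist_eq_norm]
    refine Real.le_sqrt_of_sq_le ?_
    have e : t⁻¹ • ((Z t).2 - zb.2) - u = t⁻¹ • ((Z t).2 - (zb.2 + t • u)) := by
      rw [← sub_sub, smul_sub t⁻¹ ((Z t).2 - zb.2), smul_smul, inv_mul_cancel₀ ht0.ne', one_smul]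
    rw [e, norm_smul, norm_inv, Real.norm_of_nonneg ht0.le, mul_pow, inv_pow,
      inv_mul_le_iff₀ (by positivity)]
    linarith [ht.2.1]
  have hs : Tendsto (fun k : ℕ => 1 / ((k : ℝ) + 1)) atTop (𝓝[>] 0) :=
    tendsto_nhdsWithin_iff.2 ⟨tendsto_one_div_add_atTop_nhds_zero_nat,
      Eventually.of_forall fun k => by
        have : (0 : ℝ) < 1 / ((k : ℝ) + 1) := by positivity
        exact this⟩
  obtain ⟨ξ, -, φ, hφ, hlim⟩ := (isCompact_closedBall u √c').tendsto_subseq'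
    (hs.eventually hξ).frequently
  set t : ℕ → ℝ := fun k => 1 / ((φ k : ℝ) + 1) with ht
  have htpos : ∀ k, 0 < t k := fun k => by simp only [ht]; positivity
  have htlim : Tendsto t atTop (𝓝[>] 0) := hs.comp hφ.tendsto_atTop
  have ht0 : Tendsto t atTop (𝓝 0) := htlim.mono_right nhdsWithin_le_nhds
  have hξlim : Tendsto (fun k => (t k)⁻¹ • ((Z (t k)).2 - zb.2)) atTop (𝓝 ξ) := hlim
  set v : ℕ → P × X := fun k => (t k)⁻¹ • (Z (t k) - zb) with hv
  have hvlim : Tendsto v atTop (𝓝 (0, ξ)) := (hπ.comp htlim).prodMk_nhds hξlim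
  have hZv : ∀ k, zb + t k • v k = Z (t k) := fun k => by
    simp only [hv]
    rw [smul_smul, mul_inv_cancel₀ (htpos k).ne', one_smul, add_sub_cancel]
  have hZv' : ∀ k, Z (t k) - zb = t k • v k := fun k => by rw [← hZv k, add_sub_cancel_left]
  have hquot := tendsto_second_order_quotient hq ht0 (Eventually.of_forall fun k => (htpos k).ne')
    hvlim
  have hqK : ∀ᶠ k in atTop, q (Z (t k)) ∈ K := (htlim.eventually hgood).mono fun k hk => hk.2.2
  have hv2 : Tendsto (fun k => (v k).2) atTop (𝓝 ξ) := (continuous_snd.tendsto _).comp hvlim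
  have hAv : Tendsto (fun k => A (v k)) atTop (𝓝 (A (0, ξ))) := (A.continuous.tendsto _).comp hvlim
  have hξK : A (0, ξ) ∈ K := by
    have h1 := (ht0.smul hquot).add hAv
    rw [zero_smul, zero_add] at h1
    refine K.isClosed.mem_of_tendsto h1 ?_
    filter_upwards [hqK] with k hk
    have e : t k • (t k ^ 2)⁻¹ • (q (zb + t k • v k) - t k • A (v k)) + A (v k) =
        (t k)⁻¹ • q (Z (t k)) := by
      have h2 := (htpos k).ne'
      rw [hZv, smul_smul, smul_sub, smul_smul]
      have e1 : t k * (t k ^ 2)⁻¹ = (t k)⁻¹ := by field_simp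
      rw [e1, inv_mul_cancel₀ h2, one_smul, sub_add_cancel]
    rw [e]
    exact K.smul_mem hk (inv_nonneg.2 (htpos k).le)
  have hpen : ∀ k, penalty zb A μ u w R (t k) (Z (t k)) =
      ‖(Z (t k)).1 - zb.1‖ ^ 2 / t k +
        t k ^ 2 * (R * ‖(v k).2 - u‖ ^ 2 - w (v k).2) - t k * μ (A (v k)) := by
    intro k
    have e1 : (Z (t k)).2 - zb.2 = t k • (v k).2 := by rw [← Prod.snd_sub, hZv', Prod.smul_snd]
    unfold penalty
    rw [← sub_sub, e1, ← smul_sub, norm_smul, hZv', map_smul A (t k) (v k), map_smul μ (t k),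
      map_smul w (t k),
      Real.norm_of_nonneg (htpos k).le]
    simp only [smul_eq_mul]
    ring
  -- A penalty value of order `t²` leaves no room for a negative first-order term: `μ (A (v k))` is
  -- bounded below by a multiple of `t k`.
  have hξ0 : μ (A (0, ξ)) = 0 := by
    refine le_antisymm (hμ _ hξK) ?_
    have h1 : Tendsto (fun k => t k * (-w (v k).2 - c)) atTop (𝓝 0) := by
      simpa using ht0.mul (((w.continuous.tendsto _).comp hv2).neg.sub_const c)
    refine le_of_tendsto_of_tendsto h1 ((μ.continuous.tendsto _).comp hAv) ?_
    filter_upwards [htlim.eventually (hup 1 one_pos)] with k hk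
    rw [hpen] at hk
    have h2 : 0 ≤ ‖(Z (t k)).1 - zb.1‖ ^ 2 / t k := div_nonneg (sq_nonneg _) (htpos k).le
    have h3 : 0 ≤ t k ^ 2 * (R * ‖(v k).2 - u‖ ^ 2) := by positivity
    have h4 : t k * (t k * (-w (v k).2 - c)) ≤ t k * μ (A (v k)) := by
      rw [hc]
      linarith
    exact le_of_mul_le_mul_left h4 (htpos k)
  -- Divide the upper bound by `t²`. Discarding the parameter term and adding `μ (q z) ≤ 0` turns
  -- `-t μ (A v)` into the second-order quotient of `q`.
  have hval : 2⁻¹ * μ (Q (0, ξ) (0, ξ)) + R * ‖ξ - u‖ ^ 2 - w ξ ≤ 2⁻¹ * m - w u := by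
    refine le_of_forall_pos_le_add fun ε hε => ?_
    have h1 := (((μ.continuous.tendsto _).comp hquot).add
      (((hv2.sub_const u).norm.pow 2).const_mul R)).sub ((w.continuous.tendsto _).comp hv2)
    rw [map_smul, smul_eq_mul] at h1
    refine le_of_tendsto h1 ?_
    filter_upwards [htlim.eventually (hup ε hε), hqK] with k hk hkK
    rw [hpen] at hk
    have h2 : 0 ≤ ‖(Z (t k)).1 - zb.1‖ ^ 2 / t k := div_nonneg (sq_nonneg _) (htpos k).le
    have h3 := hμ _ hkK
    have h4 := htpos k
    simp only [Function.comp, hZv, map_smul, map_sub μ, smul_eq_mul]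
    have h5 : t k ^ 2 * ((t k ^ 2)⁻¹ * (μ (q (Z (t k))) - t k * μ (A (v k)))) =
        μ (q (Z (t k))) - t k * μ (A (v k)) := by field_simp
    refine le_of_mul_le_mul_left ?_ (pow_pos h4 2)
    linarith
  -- Expanding `Q` around `u` and using `hn` and `hnu`, the linear terms cancel and `R ‖ξ - u‖² ≤ -½
  -- μ Q(ξ - u)(ξ - u)` remains.
  have hξu : ξ = u := by
    have e : ((0 : P), ξ) = (0, u) + (0, ξ - u) := by simp
    have h1 := hn ξ hξK hξ0
    have h2 : μ (Q (0, ξ) (0, ξ)) =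
        m + 2 * μ (Q (0, u) (0, ξ - u)) + μ (Q (0, ξ - u) (0, ξ - u)) := by
      rw [e]
      simp only [map_add, add_apply, hm, hsymm (0, ξ - u) (0, u)]
      ring
    have h3 : μ (Q (0, u) (0, ξ)) = m + μ (Q (0, u) (0, ξ - u)) := by
      rw [e, map_add, map_add]
    have h4 := (neg_le_abs _).trans (μ.le_opNorm (Q (0, ξ - u) (0, ξ - u)))
    have h5 : ‖μ‖ * ‖Q (0, ξ - u) (0, ξ - u)‖ ≤ ‖μ‖ * (b * ‖ξ - u‖ ^ 2) := by
      have := hb ((0 : P), ξ - u)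
      rw [Prod.norm_mk, norm_zero, max_eq_right (norm_nonneg _)] at this
      gcongr
    have h6 : (‖μ‖ * b + 1) * ‖ξ - u‖ ^ 2 ≤ R * ‖ξ - u‖ ^ 2 := by gcongr
    have h7 : 0 ≤ ‖μ‖ * (b * ‖ξ - u‖ ^ 2) := by positivity
    have h8 : ‖ξ - u‖ ^ 2 ≤ 0 := by linarith
    exact sub_eq_zero.1 (norm_eq_zero.1 (pow_eq_zero_iff two_ne_zero |>.1
      (le_antisymm h8 (sq_nonneg _))))
  rw [hξu] at hvlim hv2
  refine ⟨t, fun k => Z (t k), fun k => (μ.comp A).comp (ContinuousLinearMap.inr ℝ P X) +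
    t k • w - (2 * R) • innerSL ℝ ((Z (t k)).2 - (zb.2 + t k • u)), htpos, ht0, hvlim, ?_, ?_⟩
  · have hZlim : Tendsto (fun k => Z (t k)) atTop (𝓝 zb) := by
      have := (ht0.smul hvlim).const_add zb
      simpa only [hZv, zero_smul, add_zero] using this
    filter_upwards [hZlim.eventually (Metric.ball_mem_nhds zb hδpos)] with k hk
    exact penalty_isMinOn_normal (hZS _).1 hk (hZmin _)
  · have h1 : Tendsto (fun k => w - (2 * R) • innerSL ℝ ((v k).2 - u)) atTop (𝓝 w) := by
      have h2 := (((innerSL ℝ).continuous.tendsto _).comp (hv2.sub_const u)).const_smul (2 * R)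
      have h3 := h2.const_sub w
      rw [sub_self, map_zero, smul_zero, sub_zero] at h3
      exact h3
    refine h1.congr fun k => ?_
    have e1 : (Z (t k)).2 - (zb.2 + t k • u) = t k • ((v k).2 - u) := by
      rw [← sub_sub, ← Prod.snd_sub, hZv', Prod.smul_snd, smul_sub]
    have h2 := (htpos k).ne'
    beta_reduce
    rw [e1, add_sub_assoc, add_sub_cancel_left, map_smul, smul_comm (2 * R), smul_sub, smul_smul,
      smul_smul, inv_mul_cancel₀ h2, one_smul, one_smul]

end Core

/-! ### Second derivatives of compositions and partial derivatives -/

section Derivatives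

variable {F G H : Type*} [NormedAddCommGroup F] [NormedSpace ℝ F]
  [NormedAddCommGroup G] [NormedSpace ℝ G] [NormedAddCommGroup H] [NormedSpace ℝ H]

/-- The second derivative of a composition. -/
theorem fderiv_fderiv_comp {ψ : G → H} {φ : F → G} {a : F}
    (hψ : ContDiffAt ℝ 2 ψ (φ a)) (hφ : ContDiffAt ℝ 2 φ a) (v w : F) :
    fderiv ℝ (fderiv ℝ fun z => ψ (φ z)) a v w =
      fderiv ℝ (fderiv ℝ ψ) (φ a) (fderiv ℝ φ a v) (fderiv ℝ φ a w) +
        fderiv ℝ ψ (φ a) (fderiv ℝ (fderiv ℝ φ) a v w) := by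
  have h1 : ∀ᶠ z in 𝓝 a, DifferentiableAt ℝ φ z :=
    (hφ.eventually (by simp)).mono fun z hz => hz.differentiableAt (by norm_num)
  have h2 : ∀ᶠ z in 𝓝 a, DifferentiableAt ℝ ψ (φ z) :=
    hφ.continuousAt.eventually
      ((hψ.eventually (by simp)).mono fun z hz => hz.differentiableAt (by norm_num))
  have h3 : (fderiv ℝ fun z => ψ (φ z)) =ᶠ[𝓝 a]
      fun z => (fderiv ℝ ψ (φ z)).comp (fderiv ℝ φ z) := by
    filter_upwards [h1, h2] with z hz1 hz2 using fderiv_comp z hz2 hz1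
  have h4 : HasFDerivAt (fderiv ℝ φ) (fderiv ℝ (fderiv ℝ φ) a) a :=
    ((hφ.fderiv_right (m := 1) (by norm_num)).differentiableAt (by norm_num)).hasFDerivAt
  have h5 : HasFDerivAt (fderiv ℝ ψ) (fderiv ℝ (fderiv ℝ ψ) (φ a)) (φ a) :=
    ((hψ.fderiv_right (m := 1) (by norm_num)).differentiableAt (by norm_num)).hasFDerivAt
  have h6 := (h5.comp a h1.self_of_nhds.hasFDerivAt).clm_comp h4
  have h7 := (h6.congr_of_eventuallyEq h3).fderiv
  rw [h7]
  simp [add_comm]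

theorem fderiv_fderiv_clm_comp (L : G →L[ℝ] H) {φ : F → G} {a : F} (hφ : ContDiffAt ℝ 2 φ a)
    (v w : F) :
    fderiv ℝ (fderiv ℝ fun z => L (φ z)) a v w = L (fderiv ℝ (fderiv ℝ φ) a v w) := by
  have h0 : fderiv ℝ (fderiv ℝ (L : G → H)) (φ a) = 0 := by
    have : fderiv ℝ (L : G → H) = fun _ => L := by
      ext1 z
      exact L.fderiv
    rw [this]
    exact fderiv_const_apply L
  rw [fderiv_fderiv_comp L.contDiff.contDiffAt hφ, h0, L.fderiv]
  simp

theorem partialX_eq {φ : F × G → H} {p : F} {x : G} (hφ : DifferentiableAt ℝ φ (p, x)) :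
    partialX φ p x = (fderiv ℝ φ (p, x)).comp (ContinuousLinearMap.inr ℝ F G) :=
  (hφ.hasFDerivAt.comp x (hasFDerivAt_prodMk_right p x)).fderiv

theorem partialXX_apply {φ : F × G → H} {p : F} {x : G} (hφ : ContDiffAt ℝ 2 φ (p, x)) (u v : G) :
    partialXX φ p x u v = fderiv ℝ (fderiv ℝ φ) (p, x) (0, u) (0, v) := by
  have h1 : fderiv ℝ (fun x' : G => (p, x')) = fun _ => ContinuousLinearMap.inr ℝ F G := by
    ext1 z
    exact (hasFDerivAt_prodMk_right p z).fderiv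
  have h2 : ContDiffAt ℝ 2 (fun x' : G => (p, x')) x := contDiffAt_const.prodMk contDiffAt_id
  have h3 : fderiv ℝ (fderiv ℝ fun x' : G => (p, x')) x = 0 := by
    rw [h1]
    exact fderiv_const_apply _
  unfold partialXX
  rw [fderiv_fderiv_comp (φ := fun x' : G => (p, x')) hφ h2, h3, h1]
  simp

end Derivatives

/-! ### The system in reduced form -/

section System

variable {P X Y E : Type*}
  [NormedAddCommGroup P] [NormedSpace ℝ P]
  [NormedAddCommGroup X] [NormedSpace ℝ X]
  [NormedAddCommGroup Y] [NormedSpace ℝ Y]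
  [NormedAddCommGroup E] [NormedSpace ℝ E]
  {f : P × X → StrongDual ℝ X} {g : P × X → Y} {C : Set Y} {K : ProperCone ℝ E} {h : Y → E}
  {p : P} {x : X}

/-- The operator `𝓕_λ` in terms of the second derivative of `h ∘ g`. -/
theorem opF_apply (hf : DifferentiableAt ℝ f (p, x)) (hg : ContDiffAt ℝ 2 g (p, x))
    (hC : IsC2ConeReduction C K h (g (p, x))) (μ : StrongDual ℝ E) (u v : X) :
    opF f g h p x (μ.comp (fderiv ℝ h (g (p, x)))) u v =
      fderiv ℝ f (p, x) (0, u) v +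
        μ (fderiv ℝ (fderiv ℝ fun z => h (g z)) (p, x) (0, u) (0, v)) := by
  have hlam : ContDiffAt ℝ 2 (fun z => (μ.comp (fderiv ℝ h (g (p, x)))) (g z)) (p, x) :=
    (μ.comp (fderiv ℝ h (g (p, x)))).contDiff.contDiffAt.comp (p, x) hg
  rw [opF, opH, add_apply, add_apply, partialXX_apply hlam,
    fderiv_fderiv_clm_comp _ hg, partialX_eq hf, partialX_eq (hg.differentiableAt (by norm_num)),
    curvature, reducedMultiplier_comp h _ hC.surjective,
    fderiv_fderiv_comp hC.contDiffAt hg]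
  simp only [ContinuousLinearMap.comp_apply, ContinuousLinearMap.inr_apply, map_add]
  rw [fderiv_fderiv_clm_comp μ hC.contDiffAt]
  ring

/-- The function maximized by directional multipliers, in terms of the second derivative of
`h ∘ g`. -/
theorem directional_objective_eq (hg : ContDiffAt ℝ 2 g (p, x))
    (hC : IsC2ConeReduction C K h (g (p, x))) (μ : StrongDual ℝ E) (v : P × X) :
    (μ.comp (fderiv ℝ h (g (p, x)))) (fderiv ℝ (fderiv ℝ g) (p, x) v v) +
      curvature h (g (p, x)) (μ.comp (fderiv ℝ h (g (p, x)))) (fderiv ℝ g (p, x) v)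
        (fderiv ℝ g (p, x) v) = μ (fderiv ℝ (fderiv ℝ fun z => h (g z)) (p, x) v v) := by
  rw [curvature, reducedMultiplier_comp h _ hC.surjective, fderiv_fderiv_comp hC.contDiffAt hg,
    fderiv_fderiv_clm_comp μ hC.contDiffAt, map_add, add_comm]
  rfl

/-- Robinson stability of the system reduced to the cone `K`. -/
theorem RobinsonStable.exists_reduced [CompleteSpace Y] [CompleteSpace E]
    (hRS : RobinsonStable g C p x)
    (hg : ContinuousAt g (p, x)) (hC : IsC2ConeReduction C K h (g (p, x))) :
    ∃ κ > (0 : ℝ), ∀ᶠ ze in 𝓝 ((p, x), (0 : E)), ze.2 ∈ K →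
      ∃ x', (ze.1.1, x') ∈ {z | g z ∈ C} ∧ ‖x' - ze.1.2‖ ≤ κ * ‖h (g ze.1) - ze.2‖ := by
  obtain ⟨κ, W, hW, U, hU, hle⟩ := hRS
  obtain ⟨c, hc, hev⟩ := hC.exists_near
  -- `κ + 1` makes the distance estimate strict, so a point of `Γ(p)` can be picked from the
  -- infimum. A zero residual is treated apart: the point is then feasible itself.
  refine ⟨(κ + 1) * c, by positivity, ?_⟩
  have h1 : Tendsto (fun ze : (P × X) × E => (g ze.1, ze.2)) (𝓝 ((p, x), 0))
      (𝓝 (g (p, x), 0)) :=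
    (hg.tendsto.comp (continuous_fst.tendsto' _ _ rfl)).prodMk_nhds
      (continuous_snd.tendsto' _ _ rfl)
  have h2 : ∀ᶠ ze : (P × X) × E in 𝓝 ((p, x), 0), ze.1.1 ∈ W :=
    (Continuous.tendsto' (by fun_prop) _ p rfl :
      Tendsto (fun ze : (P × X) × E => ze.1.1) (𝓝 ((p, x), 0)) (𝓝 p)) hW
  have h3 : ∀ᶠ ze : (P × X) × E in 𝓝 ((p, x), 0), ze.1.2 ∈ U :=
    (Continuous.tendsto' (by fun_prop) _ x rfl :
      Tendsto (fun ze : (P × X) × E => ze.1.2) (𝓝 ((p, x), 0)) (𝓝 x)) hU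
  filter_upwards [h1.eventually hev, h2, h3] with ze hze hzW hzU hK
  obtain ⟨y', hy', hd⟩ := hze hK
  rcases (norm_nonneg (h (g ze.1) - ze.2)).eq_or_lt with h0 | hpos
  · rw [← h0, mul_zero] at hd
    have hy : y' = g ze.1 := sub_eq_zero.1 (norm_eq_zero.1 (le_antisymm hd (norm_nonneg _)))
    exact ⟨ze.1.2, by simpa [hy] using hy', by simp [← h0]⟩
  · have h4 : Metric.infEDist (g ze.1) C ≤ ENNReal.ofReal (c * ‖h (g ze.1) - ze.2‖) := by
      refine (Metric.infEDist_le_edist_of_mem hy').trans ?_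
      rw [edist_dist, dist_comm, dist_eq_norm]
      exact ENNReal.ofReal_le_ofReal hd
    have h5 : Metric.infEDist ze.1.2 (feasibleSet g C ze.1.1) <
        ENNReal.ofReal ((κ + 1) * c * ‖h (g ze.1) - ze.2‖) := by
      refine (hle _ hzW _ hzU).trans_lt ?_
      calc (κ : ℝ≥0∞) * Metric.infEDist (g (ze.1.1, ze.1.2)) C
          ≤ (κ : ℝ≥0∞) * ENNReal.ofReal (c * ‖h (g ze.1) - ze.2‖) := by gcongr
        _ = ENNReal.ofReal (κ * (c * ‖h (g ze.1) - ze.2‖)) := by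
          rw [ENNReal.ofReal_mul κ.coe_nonneg, ENNReal.ofReal_coe_nnreal]
        _ < _ := by
          rw [ENNReal.ofReal_lt_ofReal_iff (by positivity)]
          nlinarith [mul_pos hc hpos]
    obtain ⟨x', hx', hlt⟩ := Metric.infEDist_lt_iff.1 h5
    refine ⟨x', hx', ?_⟩
    rw [edist_dist, ENNReal.ofReal_lt_ofReal_iff (by positivity), dist_comm, dist_eq_norm] at hlt
    exact hlt.le

/-- The critical cone is described by the linearization of the reduced system. -/
theorem mem_pvsCriticalCone_iff [CompleteSpace Y] [CompleteSpace E]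
    (hRS : RobinsonStable g C p x) (hg : ContDiffAt ℝ 2 g (p, x))
    (hC : IsC2ConeReduction C K h (g (p, x))) (ξ : X) :
    ξ ∈ pvsCriticalCone f g C p x ↔
      (fderiv ℝ h (g (p, x))).comp (fderiv ℝ g (p, x)) (0, ξ) ∈ K ∧ f (p, x) ξ = 0 := by
  have hq : HasFDerivAt (fun z => h (g z))
      ((fderiv ℝ h (g (p, x))).comp (fderiv ℝ g (p, x))) (p, x) :=
    hC.hasStrictFDerivAt.hasFDerivAt.comp (p, x)
      (hg.differentiableAt (by norm_num)).hasFDerivAt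
  have hxΓ : x ∈ feasibleSet g C p := hC.2.1
  have hq0 : h (g (p, x)) = 0 := hC.map_eq_zero
  unfold pvsCriticalCone criticalCone
  rw [mem_ofPred_eq, neg_apply, neg_eq_zero]
  refine and_congr_left fun _ => ⟨fun hξ => ?_, fun hξ => ?_⟩
  · obtain ⟨t, w, ht, ht0, hw, hmem⟩ := (mem_posTangentConeAt_iff_contingent hxΓ ξ).1 hξ
    have hd : Tendsto (fun k => (t k)⁻¹ • t k • ((0 : P), w k)) atTop (𝓝 (0, ξ)) := by
      refine (tendsto_const_nhds.prodMk_nhds hw).congr fun k => ?_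
      rw [smul_smul, inv_mul_cancel₀ (ht k).ne', one_smul]
    have hd0 : Tendsto (fun k => t k • ((0 : P), w k)) atTop (𝓝 0) := by
      have := ht0.smul (tendsto_const_nhds (x := (0 : P)) |>.prodMk_nhds hw)
      rwa [zero_smul] at this
    have hlim := hq.hasFDerivWithinAt (s := univ) |>.lim hd0 (Eventually.of_forall fun _ => mem_univ _) hd
    refine K.isClosed.mem_of_tendsto hlim ?_
    have hz : Tendsto (fun k => (p, x) + t k • ((0 : P), w k)) atTop (𝓝 (p, x)) := by
      simpa using hd0.const_add (p, x)
    filter_upwards [(hg.continuousAt.tendsto.comp hz).eventually hC.eventually_mem_iff] with k hk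
    rw [hq0, sub_zero]
    refine K.smul_mem (hk.1 ?_) (inv_nonneg.2 (ht k).le)
    simpa [feasibleSet] using hmem k
  -- The ray moves only in `x` and Robinson stability corrects only `x`, so the corrected points
  -- stay in the same `Γ(p)`.
  · refine mem_posTangentConeAt_of_approx hxΓ fun ε hε => ?_
    obtain ⟨κ, hκ, hev⟩ := hRS.exists_reduced hg.continuousAt hC
    set A := (fderiv ℝ h (g (p, x))).comp (fderiv ℝ g (p, x))
    have hT : Tendsto (fun t : ℝ => ((p, x) + t • ((0 : P), ξ), t • A (0, ξ))) (𝓝[>] 0)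
        (𝓝 ((p, x), 0)) := by
      refine Tendsto.mono_left (Continuous.tendsto' ?_ _ _ (by simp)) nhdsWithin_le_nhds
      fun_prop
    filter_upwards [hT.eventually hev, eventually_mem_nhdsWithin,
      eventually_norm_ray_remainder_le hq (0, ξ) (div_pos hε hκ)] with t ht ht0 hr
    obtain ⟨x', hx', hle⟩ := ht (K.smul_mem hξ (le_of_lt ht0))
    rw [hq0, sub_zero] at hr
    refine ⟨x', by simpa [feasibleSet] using hx', ?_⟩
    calc ‖x' - (x + t • ξ)‖ ≤ κ * ‖h (g ((p, x) + t • (0, ξ))) - t • A (0, ξ)‖ := hle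
      _ ≤ κ * (ε / κ * t) := by gcongr
      _ = ε * t := by field_simp

end System

/-! ### From tangents to solutions of perturbed systems -/

section Parametrization

variable {P₁ P₂ X Y : Type*}
  [NormedAddCommGroup P₁] [NormedSpace ℝ P₁] [CompleteSpace P₁]
  [NormedAddCommGroup P₂] [NormedSpace ℝ P₂] [CompleteSpace P₂]
  [NormedAddCommGroup X] [NormedSpace ℝ X] [CompleteSpace X]
  {f : (P₁ × P₂) × X → StrongDual ℝ X} {pbar : P₁ × P₂} {xbar : X}

/-- If the partial derivative of `f` with respect to `p₂` is surjective, then `p₂` can be adjusted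
so that `f` attains a prescribed value. -/
theorem exists_parameter_adjustment
    (hf : ContDiffAt ℝ 1 f (pbar, xbar))
    (hsurj : Function.Surjective (fderiv ℝ (fun p₂ : P₂ => f ((pbar.1, p₂), xbar)) pbar.2)) :
    ∃ c > (0 : ℝ), ∀ᶠ zy in 𝓝 ((pbar, xbar), f (pbar, xbar)), ∃ p₂ : P₂,
      f ((zy.1.1.1, p₂), zy.1.2) = zy.2 ∧ ‖p₂ - zy.1.1.2‖ ≤ c * ‖f zy.1 - zy.2‖ := by
  have hfs : HasStrictFDerivAt f (fderiv ℝ f (pbar, xbar)) (pbar, xbar) :=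
    hf.hasStrictFDerivAt (by norm_num)
  set f' := fderiv ℝ f (pbar, xbar) with hf'
  -- Adjoining the coordinates `(p₁, x)` to `f` makes metric regularity preserve them, so that only
  -- `p₂` is adjusted.
  let L : (P₁ × P₂) × X →L[ℝ] P₁ × X :=
    ((ContinuousLinearMap.fst ℝ P₁ P₂).comp (ContinuousLinearMap.fst ℝ (P₁ × P₂) X)).prod
      (ContinuousLinearMap.snd ℝ (P₁ × P₂) X)
  have hG : HasStrictFDerivAt (fun z : (P₁ × P₂) × X => (L z, f z)) (L.prod f') (pbar, xbar) :=
    L.hasStrictFDerivAt.prodMk hfs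
  have hpart : ∀ π : P₂, fderiv ℝ (fun p₂ : P₂ => f ((pbar.1, p₂), xbar)) pbar.2 π =
      f' ((0, π), 0) := by
    intro π
    have h1 : HasFDerivAt (fun p₂ : P₂ => ((pbar.1, p₂), xbar))
        ((ContinuousLinearMap.inl ℝ (P₁ × P₂) X).comp (ContinuousLinearMap.inr ℝ P₁ P₂)) pbar.2 :=
      (hasFDerivAt_prodMk_left pbar xbar).comp (g := fun q : P₁ × P₂ => (q, xbar)) pbar.2
        (hasFDerivAt_prodMk_right pbar.1 pbar.2)
    have h2 := (HasFDerivAt.comp (g := f) pbar.2 (hf' ▸ hfs.hasFDerivAt) h1).fderiv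
    have h3 := DFunLike.congr_fun h2 π
    exact h3
  have hGs : Function.Surjective (L.prod f') := by
    rintro ⟨⟨a, b⟩, y⟩
    obtain ⟨π, hπ⟩ := hsurj (y - f' ((a, 0), b))
    rw [hpart] at hπ
    refine ⟨((a, π), b), ?_⟩
    have e : ((a, π), b) = ((a, (0 : P₂)), b) + (((0 : P₁), π), (0 : X)) := by simp
    have e2 : f' ((a, π), b) = y := by rw [e, map_add, hπ, add_sub_cancel]
    simp [L, e2]
  obtain ⟨c, hc, hev⟩ := exists_preimage_dist_le_of_surjective hG hGs
  refine ⟨c, hc, ?_⟩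
  have hT : Tendsto (fun zy : ((P₁ × P₂) × X) × StrongDual ℝ X => (zy.1, (L zy.1, zy.2)))
      (𝓝 ((pbar, xbar), f (pbar, xbar)))
      (𝓝 ((pbar, xbar), (L (pbar, xbar), f (pbar, xbar)))) :=
    Continuous.tendsto' (by fun_prop) _ _ rfl
  filter_upwards [hT.eventually hev] with zy ⟨z', hz', hle⟩
  simp only [Prod.mk.injEq] at hz'
  obtain ⟨hL, hfz⟩ := hz'
  have h1 : z'.1.1 = zy.1.1.1 := (Prod.mk.inj (show (z'.1.1, z'.2) = (zy.1.1.1, zy.1.2) from hL)).1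
  have h2 : z'.2 = zy.1.2 := (Prod.mk.inj (show (z'.1.1, z'.2) = (zy.1.1.1, zy.1.2) from hL)).2
  refine ⟨z'.1.2, ?_, ?_⟩
  · rw [← hfz, ← h1, ← h2]
  · have h3 : ‖((L zy.1, f zy.1) : (P₁ × X) × StrongDual ℝ X) - (L zy.1, zy.2)‖ =
        ‖f zy.1 - zy.2‖ := by
      rw [Prod.mk_sub_mk, sub_self, Prod.norm_mk, norm_zero, max_eq_right (norm_nonneg _)]
    rw [h3] at hle
    exact ((norm_snd_le (z' - zy.1).1).trans (norm_fst_le (z' - zy.1))).trans hle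

/-- Isolated calmness of the solution map excludes that the partial normal cone mapping has a
tangent `(0, u, -∇ₓf u)` with `u ≠ 0`. -/
theorem IsolatedlyCalm.eq_zero_of_tangent {g : (P₁ × P₂) × X → Y} {C : Set Y}
    (hcalm : IsolatedlyCalm (solutionMap f g C) pbar xbar)
    (hf : ContDiffAt ℝ 1 f (pbar, xbar))
    (hindep : ∀ (p₁ : P₁) (p₂ : P₂) (x : X), g ((p₁, p₂), x) = g ((p₁, pbar.2), x))
    (hsurj : Function.Surjective (fderiv ℝ (fun p₂ : P₂ => f ((pbar.1, p₂), xbar)) pbar.2))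
    {u : X} {t : ℕ → ℝ} {z : ℕ → (P₁ × P₂) × X} {xs : ℕ → StrongDual ℝ X}
    (ht : ∀ k, 0 < t k) (ht0 : Tendsto t atTop (𝓝 0))
    (hz : Tendsto (fun k => (t k)⁻¹ • (z k - (pbar, xbar))) atTop (𝓝 (0, u)))
    (hxs : ∀ᶠ k in atTop, xs k ∈ normalCone (feasibleSet g C (z k).1) (z k).2)
    (hxs' : Tendsto (fun k => (t k)⁻¹ • (xs k + f (pbar, xbar))) atTop
      (𝓝 (-fderiv ℝ f (pbar, xbar) (0, u)))) : u = 0 := by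
  have hfd : HasFDerivAt f (fderiv ℝ f (pbar, xbar)) (pbar, xbar) :=
    (hf.differentiableAt (by norm_num)).hasFDerivAt
  have hz0 : Tendsto (fun k => z k - (pbar, xbar)) atTop (𝓝 0) := by
    have := ht0.smul hz
    simpa only [smul_smul, mul_inv_cancel₀ (ht _).ne', one_smul, zero_smul] using this
  have hz1 : Tendsto z atTop (𝓝 (pbar, xbar)) := by
    simpa using hz0.add_const (pbar, xbar)
  have hxs0 : Tendsto (fun k => -xs k) atTop (𝓝 (f (pbar, xbar))) := by
    have := ht0.smul hxs'
    simp only [smul_smul, mul_inv_cancel₀ (ht _).ne', one_smul, zero_smul] at this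
    simpa using (this.neg.add_const (f (pbar, xbar)))
  -- The first-order terms of `f (z k)` and `xs k` cancel, so the residual of the variational system
  -- is `o(t)` and so is the shift of `p₂`.
  have hfz : Tendsto (fun k => (t k)⁻¹ • (f (z k) - -xs k)) atTop (𝓝 0) := by
    have h1 := (hfd.hasFDerivWithinAt (s := univ)).lim hz0
      (Eventually.of_forall fun _ => mem_univ _) hz
    have h2 := h1.add hxs'
    rw [add_neg_cancel] at h2
    refine h2.congr fun k => ?_
    rw [add_sub_cancel, ← smul_add]
    congr 1
    abel
  obtain ⟨c, hc, hadj⟩ := exists_parameter_adjustment hf hsurj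
  have hev : ∀ᶠ k in atTop, ∃ p₂ : P₂, f (((z k).1.1, p₂), (z k).2) = -xs k ∧
      ‖p₂ - (z k).1.2‖ ≤ c * ‖f (z k) - -xs k‖ :=
    (hz1.prodMk_nhds hxs0).eventually hadj
  obtain ⟨N, hN⟩ := eventually_atTop.1 hev
  have hev' : ∀ k, ∃ p₂ : P₂, N ≤ k → f (((z k).1.1, p₂), (z k).2) = -xs k ∧
      ‖p₂ - (z k).1.2‖ ≤ c * ‖f (z k) - -xs k‖ := by
    intro k
    by_cases hk : N ≤ k
    · obtain ⟨p₂, hp⟩ := hN k hk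
      exact ⟨p₂, fun _ => hp⟩
    -- An arbitrary value; only indices `k ≥ N` matter.
    · exact ⟨0, fun h => absurd h hk⟩
  choose p₂ hp₂ using hev'
  set p : ℕ → P₁ × P₂ := fun k => ((z k).1.1, p₂ k)
  have hp : Tendsto (fun k => (t k)⁻¹ • (p k - pbar)) atTop (𝓝 0) := by
    have h1 : Tendsto (fun k => (t k)⁻¹ • (p₂ k - (z k).1.2)) atTop (𝓝 0) := by
      rw [tendsto_zero_iff_norm_tendsto_zero]
      have h2 := hfz.norm.const_mul c
      rw [norm_zero, mul_zero] at h2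
      refine squeeze_zero' (Eventually.of_forall fun _ => norm_nonneg _) ?_ h2
      filter_upwards [eventually_ge_atTop N] with k hk
      rw [norm_smul, norm_smul, mul_left_comm]
      exact mul_le_mul_of_nonneg_left (hp₂ k hk).2 (norm_nonneg _)
    have h3 : Tendsto (fun k => (t k)⁻¹ • ((z k).1 - pbar)) atTop (𝓝 0) :=
      (continuous_fst.tendsto _).comp hz
    have h4 := h3.add ((tendsto_const_nhds (x := (0 : P₁))).prodMk_nhds h1)
    rw [Prod.mk_zero_zero, add_zero] at h4
    refine h4.congr fun k => ?_
    have e : p k - pbar = ((z k).1 - pbar) + ((0 : P₁), p₂ k - (z k).1.2) := by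
      ext <;> simp [p]
    rw [e, smul_add]
    congr 1
    ext <;> simp
  have hx : Tendsto (fun k => (t k)⁻¹ • ((z k).2 - xbar)) atTop (𝓝 u) :=
    (continuous_snd.tendsto _).comp hz
  have hplim : Tendsto p atTop (𝓝 pbar) := by
    have := (ht0.smul hp).add_const pbar
    simpa only [smul_smul, mul_inv_cancel₀ (ht _).ne', one_smul, smul_zero, zero_add,
      sub_add_cancel] using this
  have hxlim : Tendsto (fun k => (z k).2) atTop (𝓝 xbar) := (continuous_snd.tendsto _).comp hz1
  obtain ⟨ℓ, hℓ, Q, hQ, U, hU, hle⟩ := hcalm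
  have hfin : ∀ᶠ k in atTop, ‖(t k)⁻¹ • ((z k).2 - xbar)‖ ≤ ℓ * ‖(t k)⁻¹ • (p k - pbar)‖ := by
    filter_upwards [hplim.eventually hQ, hxlim.eventually hU, hxs, eventually_ge_atTop N]
      with k hkQ hkU hkx hkN
    have hmem : (z k).2 ∈ solutionMap f g C (p k) := by
      have e1 : feasibleSet g C (p k) = feasibleSet g C (z k).1 := by
        ext x
        simp only [feasibleSet, mem_ofPred_eq, p]
        rw [hindep, ← hindep (z k).1.1 (z k).1.2]
      have e2 : -f (p k, (z k).2) = xs k := by rw [(hp₂ k hkN).1, neg_neg]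
      change -f (p k, (z k).2) ∈ normalCone (feasibleSet g C (p k)) (z k).2
      rwa [e1, e2]
    rw [norm_smul, norm_smul, mul_left_comm]
    exact mul_le_mul_of_nonneg_left (hle _ hkQ _ ⟨hmem, hkU⟩) (norm_nonneg _)
  have hlim := le_of_tendsto_of_tendsto hx.norm (hp.norm.const_mul ℓ) hfin
  rw [norm_zero, mul_zero] at hlim
  exact norm_le_zero_iff.1 hlim

end Parametrization

/-! ### Range condition and conclusion -/

/-- Under the range condition all multipliers are directional. -/
theorem mem_directionalMultipliers_of_rangeCondition {P X Y E : Type*}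
    [NormedAddCommGroup P] [NormedSpace ℝ P]
    [NormedAddCommGroup X] [NormedSpace ℝ X]
    [NormedAddCommGroup Y] [NormedSpace ℝ Y] [CompleteSpace Y]
    [NormedAddCommGroup E] [NormedSpace ℝ E] [FiniteDimensional ℝ E]
    {f : P × X → StrongDual ℝ X} {g : P × X → Y} {C : Set Y} {K : ProperCone ℝ E} {h : Y → E}
    {p : P} {x : X} (hg : ContDiffAt ℝ 2 g (p, x)) (hC : IsC2ConeReduction C K h (g (p, x)))
    (hrange : RangeCondition f g C K h p x) {u : X} (hu : u ∈ pvsCriticalCone f g C p x)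
    {lam : StrongDual ℝ Y} (hlam : lam ∈ normalCone C (g (p, x))) :
    lam ∈ directionalMultipliers g C h (p, x) (lam.comp (fderiv ℝ g (p, x))) (0, u) := by
  refine ⟨⟨hlam, rfl⟩, isMaxOn_iff.2 ?_⟩
  rintro lam' ⟨hlam', heq⟩
  obtain ⟨μ, hμ, rfl⟩ := (mem_normalCone_iff_of_isC2ConeReduction hC lam).1 hlam
  obtain ⟨ν, hν, rfl⟩ := (mem_normalCone_iff_of_isC2ConeReduction hC lam').1 hlam'
  rw [directional_objective_eq hg hC, directional_objective_eq hg hC]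
  have hr := hrange u hu
  have e : fderiv ℝ h (g (p, x)) (partialXX g p x u u) +
        fderiv ℝ (fderiv ℝ h) (g (p, x)) (partialX g p x u) (partialX g p x u) =
      fderiv ℝ (fderiv ℝ fun z => h (g z)) (p, x) (0, u) (0, u) := by
    rw [fderiv_fderiv_comp hC.contDiffAt hg, partialXX_apply hg,
      partialX_eq (hg.differentiableAt (by norm_num)), add_comm]
    rfl
  rw [e] at hr
  obtain ⟨a, ⟨v, rfl⟩, l, hl, hal⟩ := Submodule.mem_sup.1 hr
  -- The polar of `K` annihilates `lin K`, so the objective depends on the multiplier only through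
  -- its values on the range of `∇h ∘ ∇g`, which are prescribed.
  have hzero : ∀ ρ : StrongDual ℝ E, (∀ k ∈ K, ρ k ≤ 0) → ρ l = 0 := by
    intro ρ hρ
    have h1 := hρ l hl.1
    have h2 := hρ (-l) hl.2
    rw [map_neg] at h2
    linarith
  have hv := DFunLike.congr_fun heq v
  simp only [ContinuousLinearMap.comp_apply] at hv
  rw [← hal, map_add, map_add, hzero μ hμ, hzero ν hν]
  simpa using hv.le

/-- Isolated calmness implies the second-order condition with directional multipliers. -/
theorem secondOrderCondition_of_isolatedlyCalm
    {P₁ P₂ X Y E : Type*}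
    [NormedAddCommGroup P₁] [NormedSpace ℝ P₁] [FiniteDimensional ℝ P₁]
    [NormedAddCommGroup P₂] [NormedSpace ℝ P₂] [FiniteDimensional ℝ P₂]
    [NormedAddCommGroup X] [InnerProductSpace ℝ X] [FiniteDimensional ℝ X]
    [NormedAddCommGroup Y] [NormedSpace ℝ Y] [CompleteSpace Y]
    [NormedAddCommGroup E] [NormedSpace ℝ E] [FiniteDimensional ℝ E]
    {f : (P₁ × P₂) × X → StrongDual ℝ X} {g : (P₁ × P₂) × X → Y}
    {C : Set Y} {K : ProperCone ℝ E} {h : Y → E} {pbar : P₁ × P₂} {xbar : X}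
    (hf : ContDiffAt ℝ 1 f (pbar, xbar)) (hg : ContDiffAt ℝ 2 g (pbar, xbar))
    (hC : IsC2ConeReduction C K h (g (pbar, xbar)))
    (hRS : RobinsonStable g C pbar xbar)
    (hcalm : IsolatedlyCalm (solutionMap f g C) pbar xbar)
    (hindep : ∀ (p₁ : P₁) (p₂ : P₂) (x : X), g ((p₁, p₂), x) = g ((p₁, pbar.2), x))
    (hsurj : Function.Surjective (fderiv ℝ (fun p₂ : P₂ => f ((pbar.1, p₂), xbar)) pbar.2)) :
    SecondOrderCondition f g C h pbar xbar := by
  have := FiniteDimensional.complete ℝ P₁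
  have := FiniteDimensional.complete ℝ P₂
  have := FiniteDimensional.complete ℝ X
  have := FiniteDimensional.complete ℝ E
  intro u hu hu0 lam hlam lam' hlam'
  by_contra! hcon
  obtain ⟨hle, hge⟩ := hcon
  obtain ⟨⟨hN', hcomp⟩, hmax⟩ := hlam'
  obtain ⟨μ, hμ, rfl⟩ := (mem_normalCone_iff_of_isC2ConeReduction hC lam').1 hN'
  have hgd : DifferentiableAt ℝ g (pbar, xbar) := hg.differentiableAt (by norm_num)
  have hfd : DifferentiableAt ℝ f (pbar, xbar) := hf.differentiableAt (by norm_num)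
  set zb : (P₁ × P₂) × X := (pbar, xbar) with hzb
  set A : (P₁ × P₂) × X →L[ℝ] E := (fderiv ℝ h (g zb)).comp (fderiv ℝ g zb) with hA
  set Q : (P₁ × P₂) × X →L[ℝ] (P₁ × P₂) × X →L[ℝ] E :=
    fderiv ℝ (fderiv ℝ fun z => h (g z)) zb with hQ
  have hq2 : ContDiffAt ℝ 2 (fun z => h (g z)) zb := hC.contDiffAt.comp zb hg
  have hqd : fderiv ℝ (fun z => h (g z)) zb = A :=
    fderiv_comp zb (hC.contDiffAt.differentiableAt (by norm_num)) hgd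
  have hq : (fun z => h (g z) - A (z - zb) - (2⁻¹ : ℝ) • Q (z - zb) (z - zb)) =o[𝓝 zb]
      fun z => ‖z - zb‖ ^ 2 := by
    have := taylor_two_isLittleO hq2
    simpa only [hC.map_eq_zero, sub_zero, hqd] using this
  have hsymm : ∀ v w, Q v w = Q w v := fun v w => (hq2.isSymmSndFDerivAt (by simp)).eq v w
  -- The directional multiplier has the same image under `∇g*` as `lam`, so it too satisfies the
  -- stationarity equation.
  have hstat : ∀ ξ, f zb ξ + μ (A (0, ξ)) = 0 := by
    intro ξ
    have h1 := DFunLike.congr_fun hlam.2 ξ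
    have h2 := DFunLike.congr_fun hcomp ((0 : P₁ × P₂), ξ)
    rw [partialX_eq hgd] at h1
    simp only [add_apply, ContinuousLinearMap.comp_apply, ContinuousLinearMap.inr_apply,
      zero_apply] at h1 h2
    simp only [hA, ContinuousLinearMap.comp_apply]
    rw [h2]
    exact h1
  have hcrit : ∀ ξ, ξ ∈ pvsCriticalCone f g C pbar xbar ↔ A (0, ξ) ∈ K ∧ μ (A (0, ξ)) = 0 := by
    intro ξ
    rw [mem_pvsCriticalCone_iff hRS hg hC]
    refine and_congr_right fun _ => ?_
    have := hstat ξ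
    constructor <;> intro h0 <;> linarith
  obtain ⟨κ, hκ, hRS'⟩ := hRS.exists_reduced hg.continuousAt hC
  obtain ⟨δ, hδ, hδg⟩ : ∃ δ > 0, ContinuousOn g (Metric.closedBall zb δ) := by
    obtain ⟨δ, hδ, hball⟩ := Metric.eventually_nhds_iff_ball.1 (hg.eventually (by simp))
    exact ⟨δ / 2, half_pos hδ, fun z hz => (hball z
      (Metric.closedBall_subset_ball (half_lt_self hδ) hz)).continuousAt.continuousWithinAt⟩
  have hclosed : IsClosed ({z | g z ∈ C} ∩ Metric.closedBall zb δ) := by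
    rw [inter_comm]
    exact hδg.preimage_isClosed_of_isClosed Metric.isClosed_closedBall hC.1
  have hΩK : ∀ᶠ z in 𝓝 zb, z ∈ {z | g z ∈ C} → h (g z) ∈ K :=
    (hg.continuousAt.eventually hC.eventually_mem_iff).mono fun z hz => hz.1
  have hmax' : ∀ ν : StrongDual ℝ E, (∀ k ∈ K, ν k ≤ 0) → ν.comp A = μ.comp A →
      ν (Q (0, u) (0, u)) ≤ μ (Q (0, u) (0, u)) := by
    intro ν hν hνA
    have h1 := isMaxOn_iff.1 hmax (ν.comp (fderiv ℝ h (g zb)))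
      ⟨(mem_normalCone_iff_of_isC2ConeReduction hC _).2 ⟨ν, hν, rfl⟩, by
        rw [← hcomp]
        exact hνA⟩
    rwa [directional_objective_eq hg hC, directional_objective_eq hg hC] at h1
  obtain ⟨huK, huμ⟩ := (hcrit u).1 hu
  obtain ⟨t, z, xs, ht, ht0, hz, hxs, hxs'⟩ :=
    exists_normals_in_direction (u := u) (w := -fderiv ℝ f zb (0, u))
      (show zb ∈ {z | g z ∈ C} from hC.2.1) hδ hclosed hq hsymm hΩK hκ hRS' hμ hmax' huK huμ
      -- The negated alternative says exactly that `w - μ Q(0,u)(0,·)` is nonpositive on the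
      -- critical cone and nonnegative at `u`.
      (fun ξ h1 h2 => by
        have := hge ξ ((hcrit ξ).2 ⟨h1, h2⟩)
        rw [opF_apply hfd hg hC] at this
        rw [neg_apply]
        linarith)
      (by
        rw [opF_apply hfd hg hC] at hle
        rw [neg_apply]
        linarith)
  refine hu0 (hcalm.eq_zero_of_tangent hf hindep hsurj ht ht0 hz hxs (hxs'.congr fun k => ?_))
  congr 1
  rw [sub_eq_add_neg]
  congr 1
  ext ξ
  have := hstat ξ
  simp only [neg_apply, ContinuousLinearMap.comp_apply, ContinuousLinearMap.inr_apply]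
  linarith

end PVS

theorem mainTheorem9
    {P₁ P₂ X Y E : Type*}
    [NormedAddCommGroup P₁] [InnerProductSpace ℝ P₁] [FiniteDimensional ℝ P₁]
    [NormedAddCommGroup P₂] [InnerProductSpace ℝ P₂] [FiniteDimensional ℝ P₂]
    [NormedAddCommGroup X] [InnerProductSpace ℝ X] [FiniteDimensional ℝ X]
    [NormedAddCommGroup Y] [InnerProductSpace ℝ Y] [FiniteDimensional ℝ Y]
    [NormedAddCommGroup E] [InnerProductSpace ℝ E] [FiniteDimensional ℝ E]
    (f : (P₁ × P₂) × X → StrongDual ℝ X) (g : (P₁ × P₂) × X → Y)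
    (C : Set Y) (K : ProperCone ℝ E) (h : Y → E)
    (pbar : P₁ × P₂) (xbar : X)
    (hf : ContDiffAt ℝ 1 f (pbar, xbar))
    (hg : ContDiffAt ℝ 2 g (pbar, xbar))
    (hC : PVS.IsC2ConeReduction C K h (g (pbar, xbar)))
    (hx : xbar ∈ PVS.solutionMap f g C pbar)
    (hRS : PVS.RobinsonStable g C pbar xbar)
    (hcalm : PVS.IsolatedlyCalm (PVS.solutionMap f g C) pbar xbar)
    (hindep : ∀ (p₁ : P₁) (p₂ : P₂) (x : X), g ((p₁, p₂), x) = g ((p₁, pbar.2), x))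
    (hsurj : Function.Surjective (fderiv ℝ (fun p₂ : P₂ => f ((pbar.1, p₂), xbar)) pbar.2)) :
    PVS.SecondOrderCondition f g C h pbar xbar ∧
      (PVS.RangeCondition f g C K h pbar xbar →
        PVS.StrongSecondOrderCondition f g C h pbar xbar) := by
  have := FiniteDimensional.complete ℝ Y
  have hsoc := PVS.secondOrderCondition_of_isolatedlyCalm hf hg hC hRS hcalm hindep hsurj
  -- Under the range condition part (a) may be used with `lam` as its own directional multiplier.
  exact ⟨hsoc, fun hrange u hu hu0 lam hlam => hsoc u hu hu0 lam hlam lam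
    (PVS.mem_directionalMultipliers_of_rangeCondition hg hC hrange hu hlam.1)⟩
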